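/- \textbf{Setting.} For $k\ge 3$, a $k$-graph is a $k$-uniform hypergraph. A legal $2$-colouring of a $k$-graph colours its vertices with two colours so that no edge is monochromatic, and a $k$-graph is $2$-colourable if it has a legal $2$-colouring. Algorithms are deterministic random access programs: they receive the number $n$ of vertices and the number $k$, and they access the input $k$-graph $\mathcal H$ on the vertex set $\{0,\dots,n-1\}$ by edge queries ``is $\{v_1,\dots,v_k\}$ an edge of $\mathcal H$?''. Every elementary instruction (assignment of a constant, addition, truncated subtraction, reading or writing a memory cell), every comparison and every edge query takes one unit of time. For such an algorithm $A$ let $T_A(\mathcal H)$ be its running time on input $\mathcal H$, and let $T_A(n)$ be the average of $T_A(\mathcal H)$ over all $2$-colourable $k$-graphs $\mathcal H$ on $n$ (labelled) vertices. \textbf{Theorem.} There is a deterministic algorithm $A$ that, for every $k\ge 3$, halts on every $2$-colourable $k$-graph and outputs a legal $2$-colouring of it, and whose average running time over the $2$-colourable $k$-graphs on $n$ vertices is $T_A(n)=n^{O(k)}$. That is, there is an absolute constant $C$ such that for every $k\ge 3$ and all sufficiently large $n$ (depending on $k$), $T_A(n)\le n^{Ck}$. -/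

import Mathlib

open Filter

/-- A `k`-uniform hypergraph (`k`-graph) with vertex set `V`: a finite set of edges, each of which
is a set of exactly `k` vertices. -/
structure KGraph (k : ℕ) (V : Type*) where
  edges : Finset (Finset V)
  sized : (edges : Set (Finset V)).Sized k

namespace KGraph

/-- `c` is a legal 2-colouring: every edge has two vertices of different colours. -/
def IsTwoColoring {k : ℕ} {V : Type*} (H : KGraph k V) (c : V → Bool) : Prop :=
  ∀ e ∈ H.edges, ∃ u ∈ e, ∃ v ∈ e, c u ≠ c v

def TwoColorable {k : ℕ} {V : Type*} (H : KGraph k V) : Prop :=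
  ∃ c : V → Bool, H.IsTwoColoring c

/-- The answer to the edge query "is `{v 0, …, v (k - 1)}` an edge of `H`?". Vertices are named
by the numbers below `n`. Repeated vertices and numbers `≥ n` lead to a negative answer. -/
def ask {k n : ℕ} (H : KGraph k (Fin n)) (v : Fin k → ℕ) : Bool :=
  decide (∃ e ∈ H.edges, e.map Fin.valEmbedding = Finset.univ.image v)

/-- `k`-graphs on a finite vertex set are the elements of a finite subtype. -/
def equivSubtype (k : ℕ) (V : Type*) :
    KGraph k V ≃ {E : Finset (Finset V) // (E : Set (Finset V)).Sized k} where
  toFun H := ⟨H.edges, H.sized⟩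
  invFun E := ⟨E.1, E.2⟩
  left_inv _ := rfl
  right_inv _ := rfl

noncomputable instance (k : ℕ) (V : Type*) [Fintype V] : Fintype (KGraph k V) :=
  haveI : Finite (KGraph k V) := Finite.of_equiv _ (equivSubtype k V).symm
  Fintype.ofFinite _

open Classical in
/-- The set of all 2-colourable `k`-graphs with vertex set `{0, …, n - 1}`. -/
noncomputable def twoColorable (k n : ℕ) : Finset (KGraph k (Fin n)) :=
  Finset.univ.filter fun H => H.TwoColorable

end KGraph

/-! ### Deterministic random access programs with edge queries -/

/-- The store of a random access machine: registers, and a memory that is addressed indirectly. -/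
@[ext]
structure Store where
  reg : ℕ → ℕ
  mem : ℕ → ℕ

/-- Elementary instructions; `r`, `a`, `b` name registers. There is no multiplication, division
or bit operation, so that unit cost is a realistic measure. -/
inductive Instr where
  /-- `reg r := c` -/
  | const (r c : ℕ)
  /-- `reg r := reg a + reg b` -/
  | add (r a b : ℕ)
  /-- `reg r := reg a - reg b`, and `0` if this is negative -/
  | sub (r a b : ℕ)
  /-- `reg r := mem (reg a)` -/
  | load (r a : ℕ)
  /-- `mem (reg a) := reg b` -/
  | store (a b : ℕ)
  /-- `reg r := 1` or `0` according to whether the `k` memory cells from address `reg a` on hold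
  the vertices of an edge -/
  | query (r a : ℕ)

/-- The effect of one elementary instruction, where `q` answers the edge queries. -/
def Instr.apply {k : ℕ} (q : (Fin k → ℕ) → Bool) (s : Store) : Instr → Store
  | .const r c => { s with reg := Function.update s.reg r c }
  | .add r a b => { s with reg := Function.update s.reg r (s.reg a + s.reg b) }
  | .sub r a b => { s with reg := Function.update s.reg r (s.reg a - s.reg b) }
  | .load r a => { s with reg := Function.update s.reg r (s.mem (s.reg a)) }
  | .store a b => { s with mem := Function.update s.mem (s.reg a) (s.reg b) }
  | .query r a =>
      let answer : ℕ := (q fun i => s.mem (s.reg a + (i : ℕ))).toNat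
      { s with reg := Function.update s.reg r answer }

/-- Programs: elementary instructions, composition, branching and loops, where both kinds of test
are of the form `reg a < reg b`. -/
inductive Program where
  | instr (i : Instr)
  | seq (P Q : Program)
  /-- if `reg a < reg b` then `P` else `Q` -/
  | branch (a b : ℕ) (P Q : Program)
  /-- while `reg a < reg b` do `P` -/
  | loop (a b : ℕ) (P : Program)

namespace Program

/-- `Exec q P s t s'`: started in the store `s`, the program `P` halts after exactly `t` steps in
the store `s'`, where `q` answers the edge queries. Every elementary instruction (an edge query
included) and every evaluation of a test is one step. -/
inductive Exec {k : ℕ} (q : (Fin k → ℕ) → Bool) : Program → Store → ℕ → Store → Prop where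
  | instr (i : Instr) (s : Store) : Exec q (.instr i) s 1 (i.apply q s)
  | seq {P Q : Program} {s s' s'' : Store} {t t' : ℕ} :
      Exec q P s t s' → Exec q Q s' t' s'' → Exec q (.seq P Q) s (t + t') s''
  | branch_true {a b : ℕ} {P Q : Program} {s s' : Store} {t : ℕ} :
      s.reg a < s.reg b → Exec q P s t s' → Exec q (.branch a b P Q) s (t + 1) s'
  | branch_false {a b : ℕ} {P Q : Program} {s s' : Store} {t : ℕ} :
      ¬ s.reg a < s.reg b → Exec q Q s t s' → Exec q (.branch a b P Q) s (t + 1) s'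
  | loop_true {a b : ℕ} {P : Program} {s s' s'' : Store} {t t' : ℕ} :
      s.reg a < s.reg b → Exec q P s t s' → Exec q (.loop a b P) s' t' s'' →
        Exec q (.loop a b P) s (t + t' + 1) s''
  | loop_false {a b : ℕ} {P : Program} {s : Store} :
      ¬ s.reg a < s.reg b → Exec q (.loop a b P) s 1 s

/-- Programs are deterministic: the number of steps and the final store are determined by the
initial store and the answers to the queries. -/
theorem Exec.unique {k : ℕ} {q : (Fin k → ℕ) → Bool} {P : Program} {s s₁ s₂ : Store} {t₁ t₂ : ℕ}
    (h₁ : Exec q P s t₁ s₁) (h₂ : Exec q P s t₂ s₂) : t₁ = t₂ ∧ s₁ = s₂ := by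
  induction h₁ generalizing t₂ s₂ with
  | instr i s => cases h₂; exact ⟨rfl, rfl⟩
  | seq _ _ ih ih' =>
    cases h₂ with
    | seq g g' =>
      obtain ⟨rfl, rfl⟩ := ih g
      obtain ⟨rfl, rfl⟩ := ih' g'
      exact ⟨rfl, rfl⟩
  | branch_true h _ ih =>
    cases h₂ with
    | branch_true _ g => obtain ⟨rfl, rfl⟩ := ih g; exact ⟨rfl, rfl⟩
    | branch_false h' _ => exact absurd h h'
  | branch_false h _ ih =>
    cases h₂ with
    | branch_true h' _ => exact absurd h' h
    | branch_false _ g => obtain ⟨rfl, rfl⟩ := ih g; exact ⟨rfl, rfl⟩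
  | loop_true h _ _ ih ih' =>
    cases h₂ with
    | loop_true _ g g' =>
      obtain ⟨rfl, rfl⟩ := ih g
      obtain ⟨rfl, rfl⟩ := ih' g'
      exact ⟨rfl, rfl⟩
    | loop_false h' => exact absurd h h'
  | loop_false h =>
    cases h₂ with
    | loop_true h' _ _ => exact absurd h' h
    | loop_false _ => exact ⟨rfl, rfl⟩

/-- The initial store for an `n`-vertex `k`-graph: register `0` holds `n`, register `1` holds `k`,
everything else is `0`. The edges can be accessed by edge queries only. -/
def init (k n : ℕ) : Store where
  reg := fun r => if r = 0 then n else if r = 1 then k else 0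
  mem := fun _ => 0

/-- On input `H` the program `P` halts and outputs a legal 2-colouring of `H`, that is, it leaves
the colour (`0` or `1`) of each vertex `v` in memory cell `v`. -/
def FindsTwoColoring {k n : ℕ} (P : Program) (H : KGraph k (Fin n)) : Prop :=
  ∃ (t : ℕ) (s : Store) (c : Fin n → Bool), Exec H.ask P (init k n) t s ∧
    H.IsTwoColoring c ∧ ∀ v : Fin n, s.mem v = (c v).toNat

/-- `P` is a 2-colouring algorithm for `k`-graphs: it finds a 2-colouring of every 2-colourable
`k`-graph. -/
def IsTwoColoringAlgorithm (P : Program) (k : ℕ) : Prop :=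
  ∀ (n : ℕ) (H : KGraph k (Fin n)), H.TwoColorable → P.FindsTwoColoring H

/-- The running time of `P` on input `H`: the number of steps until `P` halts. (It is meaningful
only if `P` halts on `H`, and `0` otherwise.) -/
noncomputable def time {k n : ℕ} (P : Program) (H : KGraph k (Fin n)) : ℕ :=
  sInf {t : ℕ | ∃ s : Store, Exec H.ask P (init k n) t s}

theorem time_eq {k n : ℕ} {P : Program} {H : KGraph k (Fin n)} {t : ℕ} {s : Store}
    (h : Exec H.ask P (init k n) t s) : P.time H = t := by
  have : {t : ℕ | ∃ s : Store, Exec H.ask P (init k n) t s} = {t} := by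
    ext t'
    exact ⟨fun ⟨_, h'⟩ => (h'.unique h).1, fun h' => ⟨s, h' ▸ h⟩⟩
  rw [time, this, csInf_singleton]

/-- The average of the running time of `P` over all 2-colourable `k`-graphs on `n` vertices. -/
noncomputable def averageTime (P : Program) (k n : ℕ) : ℝ :=
  (∑ H ∈ KGraph.twoColorable k n, (P.time H : ℝ)) / ((KGraph.twoColorable k n).card : ℝ)

end Program

/-! Write `k = m + 1`, let `o` be vertex 0, and call the number of `m`-sets that form an edge both
with `o` and with `u` the codegree of `u`. In a typical 2-colourable `k`-graph the codegrees alone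
reveal a colouring.

Fix a colouring `c`. The hypergraphs that it colours legally are exactly the subsets of the family
`crossing k c` of non-monochromatic `k`-sets, so a uniform such hypergraph contains each crossing
set independently with probability 1/4 for any given pair of them. The codegree of `u` is then
concentrated around a quarter of the number of `bridges`, the `m`-sets that complete both `o` and
`u` to crossing sets. If both classes exceed `n/4`, a vertex of the colour of `o` has at least
`(n/4).choose m` more bridges than one of the other colour (`card_bridges_of_eq`,
`card_bridges_of_ne`). As `m ≥ 2`, this gap is at least quadratic in `n`, and an exponential moment
bound (`card_deviation_le`) makes the failure probability at most `n / 16 ^ n`.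

A union bound over the `2 ^ n` colourings transfers this to 2-colourable hypergraphs, since each
colouring admits at most as many hypergraphs as there are 2-colourable ones. Unbalanced colourings
are negligible: moving one vertex to the small class gains at least `4 * n` crossing sets
(`exists_card_crossing_ge`). Hence at most a fraction `n / 8 ^ n` of the 2-colourable hypergraphs
has no balanced colouring that the codegrees separate.

The program tries, for every vertex `w`, to split the vertices at the codegree of `w`, and checks
each result in time polynomial in `n ^ k`. Only if all `n` thresholds fail does it search all
colourings, at a cost of `4 ^ n` times a power of `n ^ k`. The rarity of the bad hypergraphs
outweighs this exponential factor. -/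

namespace Program

infixr:60 " ;; " => Program.seq

/-- Started in `s`, the program `P` halts within `T` steps in a store that satisfies `Q`. -/
def Within {k : ℕ} (q : (Fin k → ℕ) → Bool) (P : Program) (s : Store) (T : ℕ)
    (Q : Store → Prop) : Prop :=
  ∃ t s', t ≤ T ∧ Exec q P s t s' ∧ Q s'

/-! ### Hoare-style rules with time bounds -/

section Rules

variable {k : ℕ} {q : (Fin k → ℕ) → Bool}

theorem Within.mono {P : Program} {s : Store} {T T' : ℕ} {Q Q' : Store → Prop}
    (h : Within q P s T Q) (hT : T ≤ T') (hQ : ∀ s', Q s' → Q' s') : Within q P s T' Q' := by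
  obtain ⟨t, s', ht, he, hs⟩ := h
  exact ⟨t, s', ht.trans hT, he, hQ _ hs⟩

/-- The slack `T` lets the two arms of a `branch` share one time bound. -/
theorem Within.instr {i : Instr} {s : Store} {T : ℕ} {Q : Store → Prop}
    (h : Q (i.apply q s)) : Within q (.instr i) s (T + 1) Q :=
  ⟨1, _, by omega, .instr i s, h⟩

theorem Within.seq {P P' : Program} {s : Store} {T T' : ℕ} {R Q : Store → Prop}
    (h : Within q P s T R) (h' : ∀ s', R s' → Within q P' s' T' Q) :
    Within q (P ;; P') s (T + T') Q := by
  obtain ⟨t, s', ht, he, hs⟩ := h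
  obtain ⟨t', s'', ht', he', hs'⟩ := h' s' hs
  exact ⟨t + t', s'', by omega, .seq he he', hs'⟩

theorem Within.instr_seq {i : Instr} {P : Program} {s : Store} {T : ℕ} {Q : Store → Prop}
    (h : Within q P (i.apply q s) T Q) : Within q (.instr i ;; P) s (T + 1) Q := by
  obtain ⟨t, s', ht, he, hs⟩ := h
  exact ⟨1 + t, s', by omega, .seq (.instr i s) he, hs⟩

theorem Within.branch {a b : ℕ} {P P' : Program} {s : Store} {T : ℕ} {Q : Store → Prop}
    (h : s.reg a < s.reg b → Within q P s T Q) (h' : ¬ s.reg a < s.reg b → Within q P' s T Q) :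
    Within q (.branch a b P P') s (T + 1) Q := by
  by_cases hc : s.reg a < s.reg b
  · obtain ⟨t, s', ht, he, hs⟩ := h hc
    exact ⟨t + 1, s', by omega, .branch_true hc he, hs⟩
  · obtain ⟨t, s', ht, he, hs⟩ := h' hc
    exact ⟨t + 1, s', by omega, .branch_false hc he, hs⟩

/-- A loop with invariant `I`, indexed by the number of rounds, of which there are at most `N`. -/
theorem Within.loop {a b : ℕ} {P : Program} {I : ℕ → Store → Prop} {N T : ℕ} {s : Store}
    {Q : Store → Prop}
    (hstep : ∀ j s, j < N → I j s → s.reg a < s.reg b → Within q P s T (I (j + 1)))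
    (hlast : ∀ s, I N s → ¬ s.reg a < s.reg b) (h0 : I 0 s)
    (hQ : ∀ j s, j ≤ N → I j s → ¬ s.reg a < s.reg b → Q s) :
    Within q (.loop a b P) s (N * (T + 1) + 1) Q := by
  -- Induction on `d`, the number of rounds that may still follow.
  have key : ∀ d j s, j + d = N → I j s → Within q (.loop a b P) s (d * (T + 1) + 1) Q := by
    intro d
    induction d with
    | zero =>
      intro j s hj hI
      obtain rfl : j = N := hj
      exact ⟨1, s, by omega, .loop_false (hlast s hI), hQ _ _ le_rfl hI (hlast s hI)⟩
    | succ d ih =>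
      intro j s hj hI
      by_cases hc : s.reg a < s.reg b
      · obtain ⟨t, s', ht, he, hs⟩ := hstep j s (by omega) hI hc
        obtain ⟨t', s'', ht', he', hs'⟩ := ih (j + 1) s' (by omega) hs
        exact ⟨t + t' + 1, s'', by rw [Nat.succ_mul]; omega, .loop_true hc he he', hs'⟩
      · exact ⟨1, s, by omega, .loop_false hc, hQ _ _ (by omega) hI hc⟩
  exact key N 0 s (by omega) h0

end Rules

/-! ### The digits of a counter -/

/-- Divide register `22` by register `b`: the remainder stays in register `22`, the quotient is
added to register `24`. Register `bm` holds the predecessor of the divisor, register `3` holds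
`1`. -/
def divide (b bm : ℕ) : Program :=
  .loop bm 22 (.instr (.sub 22 22 b) ;; .instr (.add 24 24 3))

/-- Write the `reg len` lowest digits in base `reg b` of register `j` into the memory cells from
address `reg a` on. Register `22` receives the remaining quotient. -/
def decode (b bm len a j : ℕ) : Program :=
  .instr (.add 22 j 2) ;; .instr (.const 23 0) ;;
  .loop 23 len
    (.instr (.const 24 0) ;; divide b bm ;; .instr (.add 25 a 23) ;; .instr (.store 25 22) ;;
      .instr (.add 22 24 2) ;; .instr (.add 23 23 3))

section Digits

variable {k : ℕ} {q : (Fin k → ℕ) → Bool}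

theorem divide_within {b bm B x : ℕ} {s : Store} (hb : b < 22) (hbm : bm < 22)
    (hB : 0 < B) (h1 : s.reg b = B) (h2 : s.reg bm = B - 1) (h3 : s.reg 3 = 1)
    (h22 : s.reg 22 = x) (h24 : s.reg 24 = 0) :
    Within q (divide b bm) s (x * 3 + 1) (fun s' => s'.mem = s.mem ∧
      (∀ r, r ≠ 22 → r ≠ 24 → s'.reg r = s.reg r) ∧ s'.reg 22 = x % B ∧ s'.reg 24 = x / B) := by
  -- As `B` is positive, the strict test `B - 1 < reg 22` means `B ≤ reg 22`, and every round
  -- subtracts at least 1, so `x` rounds suffice.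
  apply Within.loop (T := 2) (N := x) (I := fun i s' => s'.mem = s.mem ∧
      (∀ r, r ≠ 22 → r ≠ 24 → s'.reg r = s.reg r) ∧ s'.reg 22 + i * B = x ∧ s'.reg 24 = i)
  · rintro j s' hj ⟨hm, hr, h22', h24'⟩ hlt
    rw [hr bm (by omega) (by omega), h2] at hlt
    have hb' := hr b (by omega) (by omega)
    have h3' := hr 3 (by omega) (by omega)
    apply Within.instr_seq
    apply Within.instr
    refine ⟨by simpa [Instr.apply] using hm, ?_, ?_, ?_⟩
    · intro r hr1 hr2
      simp [Instr.apply, hr1, hr2, hr r]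
    · simp [Instr.apply, hb', h1]
      rw [add_mul]
      omega
    · simp [Instr.apply, h24', h3', h3]
  · rintro s' ⟨hm, hr, h22', h24'⟩
    rw [hr bm (by omega) (by omega), h2]
    have : x ≤ x * B := Nat.le_mul_of_pos_right _ hB
    omega
  · exact ⟨rfl, fun _ _ _ => rfl, by omega, h24⟩
  · rintro j s' hj ⟨hm, hr, h22', h24'⟩ hge
    rw [hr bm (by omega) (by omega), h2] at hge
    refine ⟨hm, hr, ?_, ?_⟩
    · rw [← h22', Nat.add_mul_mod_self_right, Nat.mod_eq_of_lt (by omega)]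
    · rw [← h22', Nat.add_mul_div_right _ _ hB, Nat.div_eq_of_lt (by omega), h24']
      omega

/-- A bound for the running time of `decode` for a counter `j` and `l` digits. -/
def decodeTime (j l : ℕ) : ℕ := l * (3 * j + 7) + 3

theorem decodeTime_mono {j j' l : ℕ} (h : j ≤ j') : decodeTime j l ≤ decodeTime j' l := by
  unfold decodeTime
  gcongr

/-- Repeated division with remainder. The quotient left in register `22` tells later whether the
counter has more than `l` digits. -/
theorem decode_within {b bm len a j B l : ℕ} {s : Store} (hb : b < 22) (hbm : bm < 22)
    (hlen : len < 22) (ha : a < 22)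
    (hB : 0 < B) (h1 : s.reg b = B) (h2 : s.reg bm = B - 1) (h3 : s.reg 3 = 1) (h0 : s.reg 2 = 0)
    (hl : s.reg len = l) :
    Within q (decode b bm len a j) s (decodeTime (s.reg j) l) (fun s' =>
      (∀ r < 22, s'.reg r = s.reg r) ∧ s'.reg 22 = s.reg j / B ^ l ∧
      (∀ i < l, s'.mem (s.reg a + i) = s.reg j / B ^ i % B) ∧
      (∀ m, (m < s.reg a ∨ s.reg a + l ≤ m) → s'.mem m = s.mem m)) := by
  set x := s.reg j with hx
  have h : decodeTime x l = (l * ((3 * x + 6) + 1) + 1) + 1 + 1 := by unfold decodeTime; ring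
  rw [h]
  apply Within.instr_seq
  apply Within.instr_seq
  apply Within.loop (I := fun i s' => s'.reg 23 = i ∧ (∀ r < 22, s'.reg r = s.reg r) ∧
      s'.reg 22 = x / B ^ i ∧ (∀ i' < i, s'.mem (s.reg a + i') = x / B ^ i' % B) ∧
      (∀ m, (m < s.reg a ∨ s.reg a + i ≤ m) → s'.mem m = s.mem m))
  · rintro i s' hi ⟨h23, hr, h22, hd, hm⟩ -
    have ht : 3 * x + 6 = ((x * 3 + 1) + (1 + 1 + 1 + 1)) + 1 := by omega
    rw [ht]
    apply Within.instr_seq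
    have hle : x / B ^ i ≤ x := Nat.div_le_self _ _
    apply Within.seq (T := x * 3 + 1) (T' := 4)
    · apply (divide_within (B := B) (x := x / B ^ i) hb hbm hB ?_ ?_ ?_ ?_ ?_).mono
        (by omega) (fun _ h => h)
      · simpa [Instr.apply, Function.update_apply, show b ≠ 24 by omega, hr b hb] using h1
      · simpa [Instr.apply, Function.update_apply, show bm ≠ 24 by omega, hr bm hbm] using h2
      · simp [Instr.apply, hr, h3]
      · simp [Instr.apply, h22]
      · simp [Instr.apply]
    · rintro s1 ⟨hm1, hr1, h221, h241⟩
      have e23 : s1.reg 23 = i := by rw [hr1 23 (by omega) (by omega)]; simpa [Instr.apply] using h23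
      have er : ∀ r < 22, s1.reg r = s.reg r := by
        intro r hr'
        rw [hr1 r (by omega) (by omega)]
        simp [Instr.apply, show r ≠ 24 by omega, hr r hr']
      have em : s1.mem = s'.mem := by rw [hm1]; rfl
      have ea := er a ha
      have e2 := er 2 (by omega)
      have e3 := er 3 (by omega)
      apply Within.instr_seq
      apply Within.instr_seq
      apply Within.instr_seq
      apply Within.instr
      refine ⟨?_, ?_, ?_, ?_, ?_⟩
      · simp [Instr.apply, e23, e3, h3]
      · intro r hr'
        simp [Instr.apply, show r ≠ 22 by omega, show r ≠ 23 by omega, show r ≠ 25 by omega,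
          er r hr']
      · simp [Instr.apply, h241, e2, h0, pow_succ, Nat.div_div_eq_div_mul]
      · intro i' hi'
        by_cases hii : i' = i
        · subst hii
          simp [Instr.apply, ea, e23, h221]
        · simp only [Instr.apply, ea, e23, em]
          simp [hii, hd i' (by omega)]
      · intro m hm'
        simp only [Instr.apply, ea, e23, em]
        simp [show m ≠ s.reg a + i by omega, hm m (by omega)]
  · rintro s' ⟨h23, hr, -⟩
    rw [h23, hr len hlen, hl]
    omega
  · refine ⟨by simp [Instr.apply], ?_, ?_, by simp, ?_⟩
    · intro r hr
      simp [Instr.apply, show r ≠ 22 by omega, show r ≠ 23 by omega]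
    · simp [Instr.apply, h0, hx]
    · intro m _
      simp [Instr.apply]
  · rintro i s' hi ⟨h23, hr, h22, hd, hm⟩ hge
    rw [h23, hr len hlen, hl] at hge
    obtain rfl : i = l := by omega
    exact ⟨hr, h22, hd, hm⟩

end Digits

/-! ### Loops over all tuples of vertices -/

/-- Run `body` for all `j < n ^ k` (in register `20`), with the `k` digits of `j` in base `n` in
the memory cells from address `n` on. -/
def forTuples (body : Program) : Program :=
  .instr (.const 20 0) ;; .instr (.const 21 0) ;;
  .loop 21 3 (decode 0 4 1 0 20 ;;
    .branch 22 3 (body ;; .instr (.add 20 20 3)) (.instr (.const 21 1)))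

/-- The registers below `7` hold the constants that the programs use. -/
structure Consts (n k : ℕ) (s : Store) : Prop where
  r0 : s.reg 0 = n
  r1 : s.reg 1 = k
  r2 : s.reg 2 = 0
  r3 : s.reg 3 = 1
  r4 : s.reg 4 = n - 1
  r5 : s.reg 5 = n + k - 1
  r6 : s.reg 6 = 2

theorem Consts.congr {n k : ℕ} {s s' : Store} (h : Consts n k s)
    (hr : ∀ r < 7, s'.reg r = s.reg r) : Consts n k s' := by
  constructor
  · rw [hr 0 (by omega), h.r0]
  · rw [hr 1 (by omega), h.r1]
  · rw [hr 2 (by omega), h.r2]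
  · rw [hr 3 (by omega), h.r3]
  · rw [hr 4 (by omega), h.r4]
  · rw [hr 5 (by omega), h.r5]
  · rw [hr 6 (by omega), h.r6]

/-- A bound for the running time of `forTuples body`, where each run of `body` takes at most `T`
steps. -/
def tuplesTime (n k T : ℕ) : ℕ := (n ^ k + 1) * (T + decodeTime (n ^ k) k + 3) + 3

/-- The program never computes `n ^ k`: it stops when the quotient `j / n ^ k` left by `decode` is
nonzero. By `hI` the invariant may depend only on registers below `20` and on the colour cells below
`n`, which the bookkeeping leaves alone. -/
theorem forTuples_within {n k : ℕ} {q : (Fin k → ℕ) → Bool} (hn : 0 < n) {body : Program} {T : ℕ}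
    {I : ℕ → Store → Prop} {s : Store}
    (hC : ∀ j s, I j s → Consts n k s)
    (hI : ∀ j s s', (∀ r < 20, s'.reg r = s.reg r) → (∀ m < n, s'.mem m = s.mem m) →
      I j s → I j s')
    (hbody : ∀ j < n ^ k, ∀ s, I j s → (∀ i < k, s.mem (n + i) = j / n ^ i % n) →
      Within q body s T (fun s' => I (j + 1) s' ∧ s'.reg 20 = s.reg 20 ∧ s'.reg 21 = s.reg 21))
    (h0 : I 0 s) :
    Within q (forTuples body) s (tuplesTime n k T) (I (n ^ k)) := by
  have ht : tuplesTime n k T =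
      ((n ^ k + 1) * ((decodeTime (n ^ k) k + (T + 1 + 1)) + 1) + 1) + 1 + 1 := by
    unfold tuplesTime; ring
  rw [ht]
  apply Within.instr_seq
  apply Within.instr_seq
  -- There is one round more than there are tuples: the round `j = n ^ k` only raises the flag in
  -- register `21`.
  apply Within.loop (I := fun j s' => (j ≤ n ^ k ∧ s'.reg 20 = j ∧ s'.reg 21 = 0 ∧ I j s') ∨
    (j = n ^ k + 1 ∧ s'.reg 21 = 1 ∧ I (n ^ k) s'))
  · rintro j s1 hj (⟨hj', h20, h21, hi⟩ | ⟨rfl, -⟩) -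
    swap
    · omega
    have c := hC _ _ hi
    apply Within.seq
    · exact (decode_within (by omega) (by omega) (by omega) (by omega) hn c.r0 c.r4
        c.r3 c.r2 c.r1).mono (decodeTime_mono (by omega)) (fun _ h => h)
    rintro s2 ⟨hr, h22, hd, hm⟩
    rw [c.r0] at hd hm
    rw [h20] at h22 hd
    have hi2 : I j s2 := hI j s1 s2 (fun r hr' => hr r (by omega)) (fun m hm' => hm m (by omega)) hi
    have c2 := hC _ _ hi2
    apply Within.branch
    · intro hlt
      rw [h22, c2.r3, Nat.div_lt_iff_lt_mul (by positivity), one_mul] at hlt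
      apply Within.seq (hbody j hlt s2 hi2 hd)
      rintro s3 ⟨hi3, h203, h213⟩
      apply Within.instr (T := 0)
      left
      refine ⟨hlt, ?_, ?_, ?_⟩
      · simp [Instr.apply, h203, (hC _ _ hi3).r3, hr, h20]
      · simp [Instr.apply, h213, hr, h21]
      · refine hI _ s3 _ ?_ ?_ hi3
        · intro r hr'
          simp [Instr.apply, show r ≠ 20 by omega]
        · intro m _
          rfl
    · intro hge
      rw [h22, c2.r3, Nat.div_lt_iff_lt_mul (by positivity), one_mul] at hge
      obtain rfl : j = n ^ k := by omega
      apply Within.instr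
      right
      refine ⟨rfl, by simp [Instr.apply], ?_⟩
      refine hI _ s2 _ ?_ ?_ hi2
      · intro r hr'
        simp [Instr.apply, show r ≠ 21 by omega]
      · intro m _
        rfl
  · rintro s' (⟨h, -⟩ | ⟨-, h, hi⟩)
    · omega
    · rw [h, (hC _ _ hi).r3]
      omega
  · left
    refine ⟨by omega, by simp [Instr.apply], by simp [Instr.apply], ?_⟩
    refine hI _ s _ ?_ ?_ h0
    · intro r hr'
      simp [Instr.apply, show r ≠ 20 by omega, show r ≠ 21 by omega]
    · intro m _
      rfl
  · rintro j s' - (⟨h, -, h21, hi⟩ | ⟨-, h, hi⟩) hge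
    · rw [h21, (hC _ _ hi).r3] at hge
      omega
    · exact hi

end Program

namespace Program

/-! ### Codegrees -/

/-- The digits of `j` in base `n`, with the last of the `k` digits replaced by `u`. -/
def tupleLast (k n j u : ℕ) (i : Fin k) : ℕ := if (i : ℕ) + 1 = k then u else j / n ^ (i : ℕ) % n

/-- The number of `j < n ^ k` whose tuple of digits becomes an edge when the last entry is
replaced by `0` as well as when it is replaced by `u`. -/
def pairCount {k : ℕ} (q : (Fin k → ℕ) → Bool) (n u : ℕ) : ℕ :=
  ∑ j ∈ Finset.range (n ^ k), if q (tupleLast k n j 0) ∧ q (tupleLast k n j u) then 1 else 0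

/-- Compute `pairCount` for the vertex in register `u` in register `12`. -/
def count (u : ℕ) : Program :=
  .instr (.const 12 0) ;; forTuples
    -- Register `5` addresses the cell of the last digit, which is overwritten by vertex 0 and then
    -- by the vertex in register `u`. The closing `add 12 12 2` adds zero and serves as an idle arm.
    (.instr (.store 5 2) ;; .instr (.query 13 0) ;; .instr (.store 5 u) ;; .instr (.query 14 0) ;;
      .instr (.add 13 13 14) ;; .branch 3 13 (.instr (.add 12 12 3)) (.instr (.add 12 12 2)))

def countTime (n k : ℕ) : ℕ := tuplesTime n k 7 + 1

theorem count_within {n k : ℕ} {q : (Fin k → ℕ) → Bool} (hn : 0 < n) (hk : 0 < k) {u : ℕ}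
    (hu : u < 12) {s : Store} (c : Consts n k s) :
    Within q (count u) s (countTime n k) (fun s' =>
      (∀ r < 12, s'.reg r = s.reg r) ∧ (∀ m < n, s'.mem m = s.mem m) ∧
        s'.reg 12 = pairCount q n (s.reg u)) := by
  apply Within.instr_seq
  set I : ℕ → Store → Prop := fun j s' =>
    (∀ r < 12, s'.reg r = s.reg r) ∧ (∀ m < n, s'.mem m = s.mem m) ∧
        s'.reg 12 = ∑ j' ∈ Finset.range j,
          if q (tupleLast k n j' 0) ∧ q (tupleLast k n j' (s.reg u)) then 1 else 0 with hI
  have hC : ∀ j s', I j s' → Consts n k s' :=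
    fun j s' h => c.congr (fun r hr => h.1 r (by omega))
  refine forTuples_within (I := I) hn hC ?_ ?_ ?_
  · rintro j s1 s2 hr hm ⟨h1, h2, h3⟩
    refine ⟨fun r hr' => ?_, fun m hm' => ?_, ?_⟩
    · rw [hr r (by omega), h1 r hr']
    · rw [hm m hm', h2 m hm']
    · rw [hr 12 (by omega), h3]
  · rintro j hj s1 hI1 hd
    have c1 := hC _ _ hI1
    obtain ⟨h1, h2, h3⟩ := hI1
    -- Overwriting cell `n + k - 1` replaces precisely the last entry of the tuple.
    have hq : ∀ z, (fun i : Fin k => Function.update s1.mem (n + k - 1) z (n + (i : ℕ))) =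
        tupleLast k n j z := by
      intro z
      funext i
      have hi := i.2
      by_cases h : (i : ℕ) + 1 = k
      · rw [show n + (i : ℕ) = n + k - 1 by omega]
        simp [tupleLast, h]
      · simp [tupleLast, h, show n + (i : ℕ) ≠ n + k - 1 by omega,
          hd i i.2]
    have e0 := c1.r0
    have e2 := c1.r2
    have e3 := c1.r3
    have e5 := c1.r5
    have eu := h1 u hu
    apply Within.instr_seq
    apply Within.instr_seq
    apply Within.instr_seq
    apply Within.instr_seq
    apply Within.instr_seq
    have u13 : u ≠ 13 := by omega
    have m5 : ∀ m < n, m ≠ n + k - 1 := by intros; omega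
    apply Within.branch
    · intro hlt
      apply Within.instr (T := 0)
      refine ⟨⟨?_, ?_, ?_⟩, ?_, ?_⟩
      · intro r hr
        simp [Instr.apply, show r ≠ 12 by omega, show r ≠ 13 by omega, show r ≠ 14 by omega, h1 r hr]
      · intro m hm
        simp [Instr.apply, e5, m5 m hm, h2 m hm]
      · simp [Instr.apply, Function.update_apply, e0, e2, e3, e5, eu, u13] at hlt
        simp only [← Function.update_apply, hq] at hlt
        rw [Finset.sum_range_succ, ← h3]
        clear_value I
        clear h3 hC hd
        simp only [Instr.apply, Function.update_apply, e3]
        cases hq1 : q (tupleLast k n j 0) <;> cases hq2 : q (tupleLast k n j (s.reg u)) <;>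
          simp_all
      · simp [Instr.apply]
      · simp [Instr.apply]
    · intro hlt
      apply Within.instr (T := 0)
      refine ⟨⟨?_, ?_, ?_⟩, ?_, ?_⟩
      · intro r hr
        simp [Instr.apply, show r ≠ 12 by omega, show r ≠ 13 by omega, show r ≠ 14 by omega, h1 r hr]
      · intro m hm
        simp [Instr.apply, e5, m5 m hm, h2 m hm]
      · simp [Instr.apply, Function.update_apply, e0, e2, e3, e5, eu, u13] at hlt
        simp only [← Function.update_apply, hq] at hlt
        rw [Finset.sum_range_succ, ← h3]
        clear_value I
        clear h3 hC hd
        simp only [Instr.apply, Function.update_apply, e2]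
        cases hq1 : q (tupleLast k n j 0) <;> cases hq2 : q (tupleLast k n j (s.reg u)) <;>
          simp_all
      · simp [Instr.apply]
      · simp [Instr.apply]
  · refine ⟨fun r hr => ?_, fun m _ => rfl, ?_⟩
    · simp [Instr.apply, show r ≠ 12 by omega]
    · simp [Instr.apply]

/-! ### Checking a colouring -/

/-- No tuple of vertices that is an edge has only colours `0` or only colours `1`. -/
def Legal {k : ℕ} (q : (Fin k → ℕ) → Bool) (n : ℕ) (f : ℕ → ℕ) : Prop :=
  ∀ j < n ^ k, q (fun i => j / n ^ (i : ℕ) % n) →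
    0 < ∑ i ∈ Finset.range k, f (j / n ^ i % n) ∧ ∑ i ∈ Finset.range k, f (j / n ^ i % n) < k

theorem Legal.congr {k n : ℕ} {q : (Fin k → ℕ) → Bool} {f g : ℕ → ℕ} (hn : 0 < n)
    (h : Legal q n f) (hfg : ∀ m < n, g m = f m) : Legal q n g := by
  intro j hj hq
  have : ∑ i ∈ Finset.range k, g (j / n ^ i % n) = ∑ i ∈ Finset.range k, f (j / n ^ i % n) :=
    Finset.sum_congr rfl fun i _ => hfg _ (Nat.mod_lt _ hn)
  rw [this]
  exact h j hj hq

/-- Sum up the colours of a tuple in register `14`. -/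
def sumColors : Program :=
  .instr (.const 13 0) ;; .instr (.const 14 0) ;; .loop 13 1
    (.instr (.add 15 0 13) ;; .instr (.load 15 15) ;; .instr (.load 15 15) ;;
      .instr (.add 14 14 15) ;; .instr (.add 13 13 3))

theorem sumColors_within {n k j : ℕ} {q : (Fin k → ℕ) → Bool} {s : Store} (c : Consts n k s)
    (hd : ∀ i < k, s.mem (n + i) = j / n ^ i % n) :
    Within q sumColors s (k * 6 + 3) (fun s' => s'.mem = s.mem ∧
      (∀ r, r ≠ 13 → r ≠ 14 → r ≠ 15 → s'.reg r = s.reg r) ∧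
      s'.reg 14 = ∑ i ∈ Finset.range k, s.mem (j / n ^ i % n)) := by
  apply Within.instr_seq
  apply Within.instr_seq
  apply Within.loop (T := 5) (I := fun i s' => s'.mem = s.mem ∧
      (∀ r, r ≠ 13 → r ≠ 14 → r ≠ 15 → s'.reg r = s.reg r) ∧ s'.reg 13 = i ∧
      s'.reg 14 = ∑ i ∈ Finset.range i, s.mem (j / n ^ i % n))
  · rintro i s1 hi ⟨hm, hr, h13, h14⟩ -
    have e0 := (hr 0 (by omega) (by omega) (by omega)).trans c.r0
    have e3 := (hr 3 (by omega) (by omega) (by omega)).trans c.r3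
    apply Within.instr_seq
    apply Within.instr_seq
    apply Within.instr_seq
    apply Within.instr_seq
    apply Within.instr
    refine ⟨?_, ?_, ?_, ?_⟩
    · simpa [Instr.apply] using hm
    · intro r h1 h2 h3
      simp [Instr.apply, h1, h2, h3, hr r h1 h2 h3]
    · simp [Instr.apply, h13, e3]
    · simp [Instr.apply, h13, h14, e0, hm, hd i hi, Finset.sum_range_succ]
  · rintro s1 ⟨hm, hr, h13, h14⟩
    rw [h13, hr 1 (by omega) (by omega) (by omega), c.r1]
    omega
  · refine ⟨rfl, ?_, by simp [Instr.apply], by simp [Instr.apply]⟩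
    intro r h1 h2 h3
    simp [Instr.apply, h1, h2]
  · rintro i s1 hi ⟨hm, hr, h13, h14⟩ hge
    rw [h13, hr 1 (by omega) (by omega) (by omega), c.r1] at hge
    obtain rfl : i = k := by omega
    exact ⟨hm, hr, h14⟩

/-- Check whether the memory holds a legal colouring; register `12` receives the answer. -/
def check : Program :=
  .instr (.const 12 1) ;; forTuples
    (sumColors ;; .instr (.query 15 0) ;;
      .branch 2 15 (.branch 2 14 (.branch 14 1 (.instr (.add 12 12 2)) (.instr (.const 12 0)))
        (.instr (.const 12 0))) (.instr (.add 12 12 2)))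

def checkTime (n k : ℕ) : ℕ := tuplesTime n k (k * 6 + 8) + 1

theorem check_within {n k : ℕ} {q : (Fin k → ℕ) → Bool} (hn : 0 < n) {s : Store}
    (c : Consts n k s) :
    Within q check s (checkTime n k) (fun s' =>
      (∀ r < 12, s'.reg r = s.reg r) ∧ (∀ m < n, s'.mem m = s.mem m) ∧
        ((s'.reg 12 = 1 ∧ Legal q n s.mem) ∨ (s'.reg 12 = 0 ∧ ¬ Legal q n s.mem))) := by
  apply Within.instr_seq
  set F : ℕ → Prop := fun j => q (fun i => j / n ^ (i : ℕ) % n) →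
    0 < ∑ i ∈ Finset.range k, s.mem (j / n ^ i % n) ∧
      ∑ i ∈ Finset.range k, s.mem (j / n ^ i % n) < k with hF
  set I : ℕ → Store → Prop := fun j s' =>
    (∀ r < 12, s'.reg r = s.reg r) ∧ (∀ m < n, s'.mem m = s.mem m) ∧
        ((s'.reg 12 = 1 ∧ ∀ j' < j, F j') ∨ (s'.reg 12 = 0 ∧ ¬ ∀ j' < j, F j')) with hI
  have hC : ∀ j s', I j s' → Consts n k s' :=
    fun j s' h => c.congr (fun r hr => h.1 r (by omega))
  refine forTuples_within (I := I) hn hC ?_ ?_ ?_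
  · rintro j s1 s2 hr hm ⟨h1, h2, h3⟩
    refine ⟨fun r hr' => ?_, fun m hm' => ?_, ?_⟩
    · rw [hr r (by omega), h1 r hr']
    · rw [hm m hm', h2 m hm']
    · rwa [hr 12 (by omega)]
  · rintro j hj s1 hI1 hd
    have c1 := hC _ _ hI1
    obtain ⟨h1, h2, h3⟩ := hI1
    apply Within.seq (T' := 5) (sumColors_within c1 hd)
    rintro s2 ⟨hm, hr, h14⟩
    have hsum : ∑ i ∈ Finset.range k, s1.mem (j / n ^ i % n) =
        ∑ i ∈ Finset.range k, s.mem (j / n ^ i % n) :=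
      Finset.sum_congr rfl fun i _ => h2 _ (Nat.mod_lt _ hn)
    rw [hsum] at h14
    have e0 := (hr 0 (by omega) (by omega) (by omega)).trans c1.r0
    have e1 := (hr 1 (by omega) (by omega) (by omega)).trans c1.r1
    have e2 := (hr 2 (by omega) (by omega) (by omega)).trans c1.r2
    have e12 := hr 12 (by omega) (by omega) (by omega)
    have hq : (fun i : Fin k => s2.mem (n + (i : ℕ))) = fun i : Fin k => j / n ^ (i : ℕ) % n := by
      funext i
      rw [hm, hd i i.2]
    -- Common end of the four arms: each keeps register `12` if the tuple satisfies `F j` and clears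
    -- it otherwise.
    have fin : ∀ (s3 : Store) (x : ℕ), s3.mem = s2.mem →
        (∀ r, r ≠ 12 → r ≠ 15 → s3.reg r = s2.reg r) → s3.reg 12 = x →
        ((x = s1.reg 12 ∧ F j) ∨ (x = 0 ∧ ¬ F j)) →
        I (j + 1) s3 ∧ s3.reg 20 = s1.reg 20 ∧ s3.reg 21 = s1.reg 21 := by
      intro s3 x hm3 hr3 h12 hx
      refine ⟨⟨?_, ?_, ?_⟩, ?_, ?_⟩
      · intro r hr'
        rw [hr3 r (by omega) (by omega), hr r (by omega) (by omega) (by omega), h1 r hr']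
      · intro m hm'
        rw [hm3, hm, h2 m hm']
      · rw [h12]
        rcases hx with ⟨rfl, hf⟩ | ⟨rfl, hf⟩
        · rcases h3 with ⟨h, h'⟩ | ⟨h, h'⟩
          · refine .inl ⟨h, fun j' hj' => ?_⟩
            rcases Nat.lt_succ_iff_lt_or_eq.1 hj' with h'' | rfl
            · exact h' j' h''
            · exact hf
          · exact .inr ⟨h, fun h'' => h' fun j' hj' => h'' j' (by omega)⟩
        · exact .inr ⟨rfl, fun h'' => hf (h'' j (by omega))⟩
      · rw [hr3 20 (by omega) (by omega), hr 20 (by omega) (by omega) (by omega)]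
      · rw [hr3 21 (by omega) (by omega), hr 21 (by omega) (by omega) (by omega)]
    apply Within.instr_seq
    apply Within.branch
    · intro hlt
      simp only [Instr.apply, Function.update_apply, e0, e2, hq] at hlt
      have hq1 : q (fun i => j / n ^ (i : ℕ) % n) = true := by
        by_contra h
        rw [Bool.not_eq_true] at h
        rw [h] at hlt
        simp at hlt
      apply Within.branch
      · intro hlt2
        simp [Instr.apply, e2, h14] at hlt2
        apply Within.branch
        · intro hlt3
          simp [Instr.apply, e1, h14] at hlt3
          apply Within.instr (T := 0)
          refine fin _ (s1.reg 12) rfl ?_ ?_ (.inl ⟨rfl, fun _ => ⟨Nat.pos_of_ne_zero ?_, hlt3⟩⟩)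
          · intro r a b
            simp [Instr.apply, a, b]
          · simp [Instr.apply, e2, e12]
          · intro h
            simp [h] at hlt2
        · intro hlt3
          simp [Instr.apply, e1, h14] at hlt3
          apply Within.instr (T := 0)
          refine fin _ 0 rfl ?_ ?_ (.inr ⟨rfl, fun hf => ?_⟩)
          · intro r a b
            simp [Instr.apply, a, b]
          · simp [Instr.apply]
          · have := (hf hq1).2
            omega
      · intro hlt2
        simp only [Instr.apply, Function.update_apply, e2] at hlt2
        simp only [Nat.reduceEqDiff, if_false, h14] at hlt2
        apply Within.instr (T := 1)
        refine fin _ 0 rfl ?_ ?_ (.inr ⟨rfl, fun hf => ?_⟩)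
        · intro r a b
          simp [Instr.apply, a, b]
        · simp [Instr.apply]
        · exact hlt2 (hf hq1).1
    · intro hlt
      simp only [Instr.apply, Function.update_apply, e0, e2, hq] at hlt
      apply Within.instr (T := 2)
      refine fin _ (s1.reg 12) rfl ?_ ?_ (.inl ⟨rfl, fun hf => ?_⟩)
      · intro r a b
        simp [Instr.apply, a, b]
      · simp [Instr.apply, e2, e12]
      · simp [hf] at hlt
  · refine ⟨fun r hr => ?_, fun m _ => rfl, .inl ⟨?_, by simp⟩⟩
    · simp [Instr.apply, show r ≠ 12 by omega]
    · simp [Instr.apply]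

end Program

namespace Program

/-! ### The algorithm -/

/-- Colour the vertices by comparing their codegrees with the one of the vertex in register
`7`. -/
def colorByCount : Program :=
  count 7 ;; .instr (.add 9 12 2) ;; .instr (.const 10 0) ;;
  .loop 10 0 (count 10 ;; .branch 12 9 (.instr (.store 10 2)) (.instr (.store 10 3)) ;;
    .instr (.add 10 10 3))

/-- The colouring of the vertices whose codegree is at least the one of `w`. -/
def countColor {k : ℕ} (q : (Fin k → ℕ) → Bool) (n w u : ℕ) : ℕ :=
  if pairCount q n u < pairCount q n w then 0 else 1

/-- Try the colourings `countColor`. -/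
def tryCounts : Program :=
  .loop 7 0 (colorByCount ;; check ;;
    -- On success register `7` jumps to `n`, which ends the loop.
    .branch 2 12 (.instr (.const 8 1) ;; .instr (.add 7 0 2)) (.instr (.add 7 7 3)))

/-- Try all colourings, unless register `8` holds `1`. -/
def tryAll : Program :=
  -- The candidate is the list of the `n` binary digits of register `7`, written to the cells from 0
  -- on: register `6` holds the base 2 and register `3` its predecessor.
  .loop 8 3 (decode 6 3 0 2 7 ;; check ;;
    .branch 2 12 (.instr (.const 8 1)) (.instr (.add 7 7 3)))

def setup : Program :=
  .instr (.const 3 1) ;; .instr (.sub 4 0 3) ;; .instr (.add 5 4 1) ;; .instr (.add 6 3 3)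

/-- The algorithm: if no `countColor` is a legal colouring, try all colourings. -/
def colorer : Program :=
  .branch 2 0 (setup ;; tryCounts ;; .instr (.add 7 2 2) ;; tryAll) (.instr (.const 3 1))

section Algorithm

variable {n k : ℕ} {q : (Fin k → ℕ) → Bool}

def colorTime (n k : ℕ) : ℕ := (n + 1) * (countTime n k + 4) + 3

theorem colorByCount_within (hn : 0 < n) (hk : 0 < k) {s : Store} (c : Consts n k s) :
    Within q colorByCount s (colorTime n k) (fun s' => (∀ r < 9, s'.reg r = s.reg r) ∧
      ∀ m < n, s'.mem m = countColor q n (s.reg 7) m) := by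
  have ht : countTime n k + (1 + 1 + (n * ((countTime n k + (0 + 1 + 1 + 1)) + 1) + 1)) ≤
      colorTime n k := by unfold colorTime; linarith
  refine Within.mono ?_ ht (fun _ h => h)
  apply Within.seq (T' := 1 + 1 + (n * ((countTime n k + (0 + 1 + 1 + 1)) + 1) + 1))
    (count_within hn hk (by omega) c)
  rintro s1 ⟨hr1, hm1, h12⟩
  have ht : 1 + 1 + (n * ((countTime n k + (0 + 1 + 1 + 1)) + 1) + 1) =
    (n * ((countTime n k + (0 + 1 + 1 + 1)) + 1) + 1) + 1 + 1 := by ring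
  rw [ht]
  apply Within.instr_seq
  apply Within.instr_seq
  have c1 := c.congr (s' := s1) fun r hr => hr1 r (by omega)
  have e2 := c1.r2
  apply Within.loop (I := fun u s' => (∀ r < 9, s'.reg r = s.reg r) ∧
    s'.reg 9 = pairCount q n (s.reg 7) ∧ s'.reg 10 = u ∧
      ∀ m < n, m < u → s'.mem m = countColor q n (s.reg 7) m)
  · rintro u s2 hu ⟨hr2, h9, h10, hm2⟩ -
    have c2 := c.congr (s' := s2) fun r hr => hr2 r (by omega)
    apply Within.seq (count_within hn hk (by omega) c2)
    rintro s3 ⟨hr3, hm3, h12⟩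
    have c3 := c2.congr (s' := s3) fun r hr => hr3 r (by omega)
    have f2 := c3.r2
    have f3 := c3.r3
    have f9 := (hr3 9 (by omega)).trans h9
    have f10 := (hr3 10 (by omega)).trans h10
    rw [h10] at h12
    apply Within.seq (T := 0 + 1 + 1) (T' := 0 + 1) (R := fun s' => s'.reg = s3.reg ∧
      ∀ m < n, m < u + 1 → s'.mem m = countColor q n (s.reg 7) m)
    · apply Within.branch
      · intro hlt
        rw [h12, f9] at hlt
        apply Within.instr
        refine ⟨rfl, fun m hm hmu => ?_⟩
        by_cases h : m = u
        · simp [Instr.apply, f10, h, f2, countColor, hlt]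
        · simp [Instr.apply, f10, h, hm3 m hm, hm2 m hm (by omega)]
      · intro hlt
        rw [h12, f9] at hlt
        apply Within.instr
        refine ⟨rfl, fun m hm hmu => ?_⟩
        by_cases h : m = u
        · simp only [Instr.apply, f10, h, f3, countColor, hlt, if_false, Function.update_self]
        · simp [Instr.apply, f10, h, hm3 m hm, hm2 m hm (by omega)]
    · rintro s4 ⟨hr4, hm4⟩
      apply Within.instr
      refine ⟨fun r hr => ?_, ?_, ?_, ?_⟩
      · simp [Instr.apply, show r ≠ 10 by omega, hr4, hr3 r (by omega), hr2 r hr]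
      · simp [Instr.apply, hr4, f9]
      · simp [Instr.apply, hr4, f10, f3]
      · simpa [Instr.apply] using hm4
  · rintro s2 ⟨hr2, h9, h10, hm2⟩
    rw [h10, hr2 0 (by omega), c.r0]
    omega
  · refine ⟨fun r hr => ?_, ?_, ?_, ?_⟩
    · simp [Instr.apply, show r ≠ 9 by omega, show r ≠ 10 by omega, hr1 r (by omega)]
    · simp [Instr.apply, h12, e2]
    · simp [Instr.apply]
    · simp
  · rintro u s2 hu ⟨hr2, h9, h10, hm2⟩ hge
    rw [h10, hr2 0 (by omega), c.r0] at hge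
    exact ⟨hr2, fun m hm => hm2 m hm (by omega)⟩

/-- Memory and registers `7` and `8` between the rounds of a search for a legal colouring: either
it has been found, or round `j` is next and earlier rounds had the illegal colourings `f`. -/
def SearchState (q : (Fin k → ℕ) → Bool) (n : ℕ) (f : ℕ → ℕ → ℕ) (j : ℕ) (s : Store) : Prop :=
  Consts n k s ∧ ((s.reg 8 = 1 ∧ n ≤ s.reg 7 ∧ (∀ m < n, s.mem m ≤ 1) ∧ Legal q n s.mem) ∨
    (s.reg 8 = 0 ∧ s.reg 7 = j ∧ ∀ i < j, ¬ Legal q n (f i)))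

def tryCountsTime (n k : ℕ) : ℕ := n * (colorTime n k + checkTime n k + 4) + 1

theorem tryCounts_within (hn : 0 < n) (hk : 0 < k) {s : Store} (c : Consts n k s)
    (h7 : s.reg 7 = 0) (h8 : s.reg 8 = 0) :
    Within q tryCounts s (tryCountsTime n k) (SearchState q n (countColor q n) n) := by
  have ht : tryCountsTime n k =
      n * ((colorTime n k + (checkTime n k + (0 + 1 + 1 + 1))) + 1) + 1 := by
    unfold tryCountsTime; ring
  rw [ht]
  apply Within.loop (I := SearchState q n (countColor q n))
  · rintro w s1 hw ⟨c1, ⟨-, h, -⟩ | ⟨h8, h7, hf⟩⟩ hlt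
    · rw [c1.r0] at hlt
      omega
    apply Within.seq (colorByCount_within hn hk c1)
    rintro s2 ⟨hr2, hm2⟩
    have c2 := c1.congr (s' := s2) fun r hr => hr2 r (by omega)
    apply Within.seq (check_within hn c2)
    rintro s3 ⟨hr3, hm3, h12⟩
    have c3 := c2.congr (s' := s3) fun r hr => hr3 r (by omega)
    have f0 := c3.r0
    have f2 := c3.r2
    have f3 := c3.r3
    have f7 : s3.reg 7 = w := by rw [hr3 7 (by omega), hr2 7 (by omega), h7]
    have f8 : s3.reg 8 = 0 := by rw [hr3 8 (by omega), hr2 8 (by omega), h8]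
    rw [h7] at hm2
    apply Within.branch
    · intro hlt
      have hL : Legal q n s2.mem := by
        rcases h12 with ⟨-, h⟩ | ⟨h, -⟩
        · exact h
        · rw [h] at hlt
          omega
      apply Within.instr_seq
      apply Within.instr
      refine ⟨c3.congr fun r hr => ?_, .inl ⟨?_, ?_, ?_, ?_⟩⟩
      · simp [Instr.apply, show r ≠ 7 by omega, show r ≠ 8 by omega]
      · simp [Instr.apply]
      · simp [Instr.apply, f0, f2]
      · intro m hm
        simp only [Instr.apply, hm3 m hm, hm2 m hm, countColor]
        split_ifs <;> omega
      · exact hL.congr hn hm3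
    · intro hlt
      have hL : ¬ Legal q n s2.mem := by
        rcases h12 with ⟨h, -⟩ | ⟨-, h⟩
        · rw [h] at hlt
          omega
        · exact h
      apply Within.instr (T := 1)
      refine ⟨c3.congr fun r hr => ?_, .inr ⟨?_, ?_, ?_⟩⟩
      · simp [Instr.apply, show r ≠ 7 by omega]
      · simp [Instr.apply, f8]
      · simp [Instr.apply, f7, f3]
      · intro i hi
        rcases Nat.lt_succ_iff_lt_or_eq.1 hi with hi | rfl
        · exact hf i hi
        · exact fun h => hL (h.congr hn hm2)
  · rintro s1 ⟨c1, ⟨-, h, -⟩ | ⟨-, h, -⟩⟩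
    · rw [c1.r0]
      omega
    · rw [c1.r0]
      omega
  · exact ⟨c, .inr ⟨h8, h7, by simp⟩⟩
  · rintro j s1 hj ⟨c1, h | ⟨h8, h7, hf⟩⟩ hge
    · exact ⟨c1, .inl h⟩
    · rw [c1.r0, h7] at hge
      exact ⟨c1, .inr ⟨h8, by omega, fun i hi => hf i (by omega)⟩⟩

def tryAllTime (n k : ℕ) : ℕ := 2 ^ n * (decodeTime (2 ^ n) n + checkTime n k + 3) + 1

/-- Every tuple consists of the digits of some number. -/
theorem exists_digits {b l : ℕ} (v : Fin l → Fin b) :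
    ∃ j < b ^ l, ∀ i : Fin l, j / b ^ (i : ℕ) % b = v i :=
  ⟨finFunctionFinEquiv v, (finFunctionFinEquiv v).2, fun i => by
    conv_rhs => rw [← finFunctionFinEquiv.symm_apply_apply v]
    rfl⟩

theorem tryAll_within (hn : 0 < n) {s : Store} (c : Consts n k s)
    (h7 : s.reg 7 = 0) (h8 : s.reg 8 = 0) (hcol : ∃ f : ℕ → ℕ, (∀ m < n, f m ≤ 1) ∧ Legal q n f) :
    Within q tryAll s (tryAllTime n k) (fun s' => (∀ m < n, s'.mem m ≤ 1) ∧ Legal q n s'.mem) := by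
  have ht : tryAllTime n k =
      2 ^ n * ((decodeTime (2 ^ n) n + (checkTime n k + (0 + 1 + 1))) + 1) + 1 := by
    unfold tryAllTime; ring
  rw [ht]
  have h2n : n ≤ 2 ^ n := Nat.lt_two_pow_self.le
  -- Any legal colouring is the digit sequence of some `j < 2 ^ n`, so the search cannot exhaust its
  -- rounds.
  have hno : ¬ ∀ j < 2 ^ n, ¬ Legal q n (fun i => j / 2 ^ i % 2) := by
    obtain ⟨f, hf1, hf⟩ := hcol
    intro h
    obtain ⟨j, hj, hv⟩ := exists_digits (b := 2) (fun i : Fin n => ⟨f i, by have := hf1 i i.2; omega⟩)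
    exact h j hj (hf.congr hn fun m hm => hv ⟨m, hm⟩)
  apply Within.loop (I := fun j s' => Consts n k s' ∧
    ((s'.reg 8 = 1 ∧ (∀ m < n, s'.mem m ≤ 1) ∧ Legal q n s'.mem) ∨
    (s'.reg 8 = 0 ∧ s'.reg 7 = j ∧ ∀ i < j, ¬ Legal q n (fun m => i / 2 ^ m % 2))))
  · rintro j s1 hj ⟨c1, ⟨h, -⟩ | ⟨h8, h7, hf⟩⟩ hlt
    · rw [c1.r3, h] at hlt
      omega
    apply Within.seq
    · refine (decode_within (by omega) (by omega) (by omega) (by omega) two_pos c1.r6 c1.r3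
        c1.r3 c1.r2 c1.r0).mono (decodeTime_mono (by omega)) (fun _ h => h)
    rintro s2 ⟨hr2, -, hd, -⟩
    have hm2 : ∀ m < n, s2.mem m = j / 2 ^ m % 2 := by
      intro m hm
      rw [← h7, ← hd m hm, c1.r2, zero_add]
    have c2 := c1.congr (s' := s2) fun r hr => hr2 r (by omega)
    apply Within.seq (check_within hn c2)
    rintro s3 ⟨hr3, hm3, h12⟩
    have c3 := c2.congr (s' := s3) fun r hr => hr3 r (by omega)
    have f0 := c3.r0
    have f2 := c3.r2
    have f3 := c3.r3
    have f7 : s3.reg 7 = j := by rw [hr3 7 (by omega), hr2 7 (by omega), h7]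
    have f8 : s3.reg 8 = 0 := by rw [hr3 8 (by omega), hr2 8 (by omega), h8]
    apply Within.branch
    · intro hlt
      have hL : Legal q n s2.mem := by
        rcases h12 with ⟨-, h⟩ | ⟨h, -⟩
        · exact h
        · rw [h] at hlt
          omega
      apply Within.instr
      refine ⟨c3.congr fun r hr => ?_, .inl ⟨?_, ?_, ?_⟩⟩
      · simp [Instr.apply, show r ≠ 8 by omega]
      · simp [Instr.apply]
      · intro m hm
        simp only [Instr.apply, hm3 m hm, hm2 m hm]
        omega
      · exact hL.congr hn hm3
    · intro hlt
      have hL : ¬ Legal q n s2.mem := by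
        rcases h12 with ⟨h, -⟩ | ⟨-, h⟩
        · rw [h] at hlt
          omega
        · exact h
      apply Within.instr
      refine ⟨c3.congr fun r hr => ?_, .inr ⟨?_, ?_, ?_⟩⟩
      · simp [Instr.apply, show r ≠ 7 by omega]
      · simp [Instr.apply, f8]
      · simp [Instr.apply, f7, f3]
      · intro i hi
        rcases Nat.lt_succ_iff_lt_or_eq.1 hi with hi | rfl
        · exact hf i hi
        · exact fun h => hL (h.congr hn hm2)
  · rintro s1 ⟨c1, ⟨h, -⟩ | ⟨h8, h7, hf⟩⟩
    · rw [c1.r3, h]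
      omega
    · exact absurd hf hno
  · exact ⟨c, .inr ⟨h8, h7, by simp⟩⟩
  · rintro j s1 hj ⟨c1, ⟨-, h⟩ | ⟨h8, -⟩⟩ hge
    · exact h
    · rw [c1.r3, h8] at hge
      omega

open Classical in
-- The exhaustive search is charged only when every threshold fails; this case distinction in the
-- time bound is what the averaging exploits.
theorem colorer_within (hn : 0 < n) (hk : 0 < k)
    (hcol : ∃ f : ℕ → ℕ, (∀ m < n, f m ≤ 1) ∧ Legal q n f) :
    Within q colorer (init k n)
      (tryCountsTime n k + 7 + if ∃ w < n, Legal q n (countColor q n w) then 0 else tryAllTime n k)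
      (fun s' => (∀ m < n, s'.mem m ≤ 1) ∧ Legal q n s'.mem) := by
  set T := if ∃ w < n, Legal q n (countColor q n w) then 0 else tryAllTime n k with hT
  have ht : tryCountsTime n k + 7 + T =
      ((3 + 1) + (tryCountsTime n k + ((T + 1) + 1))) + 1 := by ring
  rw [ht]
  apply Within.branch
  swap
  · intro h
    exact absurd hn h
  intro _
  apply Within.seq (R := fun s' => Consts n k s' ∧ s'.reg 7 = 0 ∧ s'.reg 8 = 0)
  · apply Within.instr_seq
    apply Within.instr_seq
    apply Within.instr_seq
    apply Within.instr
    refine ⟨?_, ?_, ?_⟩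
    · constructor <;> simp [Instr.apply, init]
      omega
    · simp [Instr.apply, init]
    · simp [Instr.apply, init]
  rintro s1 ⟨c1, h7, h8⟩
  apply Within.seq (tryCounts_within hn hk c1 h7 h8)
  rintro s2 ⟨c2, h⟩
  have e2 := c2.r2
  have e3 := c2.r3
  apply Within.instr_seq
  rcases h with ⟨h8, -, h1, hL⟩ | ⟨h8, -, hf⟩
  · refine ⟨1, _, by omega, .loop_false ?_, ?_⟩
    · simp [Instr.apply, h8, e3]
    · exact ⟨h1, hL⟩
  · have hT' : T = tryAllTime n k := if_neg fun ⟨w, hw, h⟩ => hf w hw h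
    rw [hT']
    refine (tryAll_within hn (c2.congr fun r hr => ?_) ?_ ?_ hcol).mono (by omega) fun _ h => h
    · simp [Instr.apply, show r ≠ 7 by omega]
    · simp [Instr.apply, e2]
    · simp [Instr.apply, h8]

end Algorithm

end Program

/-! ### An exponential moment -/

section Moment

variable {α ι : Type*} [DecidableEq α] [DecidableEq ι]

/-- Independence: the pairs `{e i, f i}` are disjoint, so for a uniform subset `E` of `U` the mean
of the product factorises, and each pair lies inside `E` with probability 1/4. -/
theorem sum_powerset_prod_pairs (p r : ℝ) (e f : ι → α) (S : Finset ι) (U : Finset α)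
    (hU : ∀ i ∈ S, e i ∈ U ∧ f i ∈ U) (he : Set.InjOn e S) (hf : Set.InjOn f S)
    (hef : ∀ i ∈ S, ∀ j ∈ S, e i ≠ f j) :
    ∑ E ∈ U.powerset, ∏ i ∈ S, (if e i ∈ E ∧ f i ∈ E then p else r) =
      2 ^ U.card * ((p + 3 * r) / 4) ^ S.card := by
  induction S using Finset.induction_on generalizing U with
  | empty => simp
  | insert a S ha ih =>
    have hne : e a ≠ f a := hef a (by simp) a (by simp)
    obtain ⟨U', hU', h1, h2⟩ : ∃ U', U = insert (e a) (insert (f a) U') ∧ e a ∉ insert (f a) U' ∧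
        f a ∉ U' := by
      refine ⟨(U.erase (e a)).erase (f a), ?_, ?_, by simp⟩
      · rw [Finset.insert_erase, Finset.insert_erase (hU a (by simp)).1]
        exact Finset.mem_erase.2 ⟨hne.symm, (hU a (by simp)).2⟩
      · simp [hne]
    have h3 : e a ∉ U' := fun h => h1 (by simp [h])
    have hea : ∀ i ∈ S, e i ≠ e a := fun i hi h =>
      ha (he (by simp) (by simp [hi]) h.symm ▸ hi)
    have hfa : ∀ i ∈ S, f i ≠ f a := fun i hi h =>
      ha (hf (by simp) (by simp [hi]) h.symm ▸ hi)
    have hea' : ∀ i ∈ S, e i ≠ f a := fun i hi => hef i (by simp [hi]) a (by simp)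
    have hfa' : ∀ i ∈ S, f i ≠ e a := fun i hi => (hef a (by simp) i (by simp [hi])).symm
    have ih' := ih U' (fun i hi => by
        have := hU i (by simp [hi])
        rw [hU'] at this
        simpa [hea i hi, hfa i hi, hea' i hi, hfa' i hi] using this)
      (he.mono (by simp)) (hf.mono (by simp))
      (fun i hi j hj => hef i (by simp [hi]) j (by simp [hj]))
    -- The factors indexed by `S` do not see which of the four extensions of `E` by `e a` and `f a`
    -- is taken.
    have key : ∀ (E E' : Finset α), E ∈ U'.powerset → (∀ x, x ≠ e a → x ≠ f a → (x ∈ E' ↔ x ∈ E)) →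
        ∏ i ∈ insert a S, (if e i ∈ E' ∧ f i ∈ E' then p else r) =
        (if e a ∈ E' ∧ f a ∈ E' then p else r) *
          ∏ i ∈ S, (if e i ∈ E ∧ f i ∈ E then p else r) := by
      intro E E' _ hx
      rw [Finset.prod_insert ha]
      congr 1
      refine Finset.prod_congr rfl fun i hi => ?_
      simp only [hx _ (hea i hi) (hea' i hi), hx _ (hfa' i hi) (hfa i hi)]
    rw [hU', Finset.sum_powerset_insert h1, Finset.sum_powerset_insert h2,
      Finset.sum_powerset_insert h2, ← Finset.sum_add_distrib, ← Finset.sum_add_distrib,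
      ← Finset.sum_add_distrib, Finset.card_insert_of_notMem h1, Finset.card_insert_of_notMem h2,
      Finset.card_insert_of_notMem ha]
    have : ∀ E ∈ U'.powerset,
        (∏ i ∈ insert a S, (if e i ∈ E ∧ f i ∈ E then p else r) +
          ∏ i ∈ insert a S, (if e i ∈ insert (f a) E ∧ f i ∈ insert (f a) E then p else r)) +
        (∏ i ∈ insert a S, (if e i ∈ insert (e a) E ∧ f i ∈ insert (e a) E then p else r) +
          ∏ i ∈ insert a S, (if e i ∈ insert (e a) (insert (f a) E) ∧
            f i ∈ insert (e a) (insert (f a) E) then p else r)) =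
        (p + 3 * r) * ∏ i ∈ S, (if e i ∈ E ∧ f i ∈ E then p else r) := by
      intro E hE
      have hE' := Finset.mem_powerset.1 hE
      have n1 : e a ∉ E := fun h => h3 (hE' h)
      have n2 : f a ∉ E := fun h => h2 (hE' h)
      rw [key E E hE (by simp), key E (insert (f a) E) hE (by simp +contextual),
        key E (insert (e a) E) hE (by simp +contextual),
        key E (insert (e a) (insert (f a) E)) hE (by simp +contextual)]
      simp [n1, n2, hne, hne.symm]
      ring
    rw [Finset.sum_congr rfl this, ← Finset.mul_sum, ih']
    ring

/-- Moment generating function of a centred indicator of probability 1/4. By `exp y ≤ 1 + y + y ^ 2`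
the linear terms cancel and the mean is at most `1 + 3 * x ^ 2 / 16`. -/
theorem exp_mean_le {x : ℝ} (hx : |x| ≤ 1) :
    (Real.exp (x * (3 / 4)) + 3 * Real.exp (-(x / 4))) / 4 ≤ Real.exp (x ^ 2) := by
  have hx' := abs_le.1 hx
  have h1 := (abs_le.1 (Real.abs_exp_sub_one_sub_id_le
    (x := x * (3 / 4)) (abs_le.2 ⟨by linarith, by linarith⟩))).2
  have h2 := (abs_le.1 (Real.abs_exp_sub_one_sub_id_le
    (x := -(x / 4)) (abs_le.2 ⟨by linarith, by linarith⟩))).2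
  have h3 := Real.add_one_le_exp (x ^ 2)
  nlinarith [sq_nonneg x]

theorem sum_powerset_exp_le {x : ℝ} (hx : |x| ≤ 1) (e f : ι → α) (S : Finset ι) (U : Finset α)
    (hU : ∀ i ∈ S, e i ∈ U ∧ f i ∈ U) (he : Set.InjOn e S) (hf : Set.InjOn f S)
    (hef : ∀ i ∈ S, ∀ j ∈ S, e i ≠ f j) :
    ∑ E ∈ U.powerset, Real.exp (x * (((S.filter fun i => e i ∈ E ∧ f i ∈ E).card : ℝ) -
      S.card / 4)) ≤ 2 ^ U.card * Real.exp (x ^ 2 * S.card) := by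
  have h1 : ∀ E ∈ U.powerset, Real.exp (x * (((S.filter fun i => e i ∈ E ∧ f i ∈ E).card : ℝ) -
      S.card / 4)) =
      ∏ i ∈ S, (if e i ∈ E ∧ f i ∈ E then Real.exp (x * (3 / 4)) else Real.exp (-(x / 4))) := by
    intro E _
    have : ∀ i ∈ S, (if e i ∈ E ∧ f i ∈ E then Real.exp (x * (3 / 4)) else Real.exp (-(x / 4))) =
        Real.exp (x * ((if e i ∈ E ∧ f i ∈ E then 1 else 0) - 1 / 4)) := by
      intro i _
      split_ifs <;> congr 1 <;> ring
    rw [Finset.prod_congr rfl this, ← Real.exp_sum, ← Finset.mul_sum, Finset.sum_sub_distrib]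
    simp
    left
    ring
  rw [Finset.sum_congr rfl h1, sum_powerset_prod_pairs _ _ e f S U hU he hf hef]
  gcongr
  calc _ ≤ Real.exp (x ^ 2) ^ S.card := by
        gcongr
        exact exp_mean_le hx
    _ = _ := by rw [← Real.exp_nat_mul, mul_comm]

/-- Among the subsets `E` of `U`, few contain a number of pairs `e i`, `f i` that deviates from
the mean by `δ` or more. -/
theorem card_deviation_le {x δ : ℝ} (hx0 : 0 ≤ x) (hx : x ≤ 1) (e f : ι → α) (S : Finset ι)
    (U : Finset α) (hU : ∀ i ∈ S, e i ∈ U ∧ f i ∈ U) (he : Set.InjOn e S) (hf : Set.InjOn f S)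
    (hef : ∀ i ∈ S, ∀ j ∈ S, e i ≠ f j) :
    (((U.powerset.filter fun E => δ ≤ |((S.filter fun i => e i ∈ E ∧ f i ∈ E).card : ℝ) -
      S.card / 4|).card : ℕ) : ℝ) ≤ 2 * 2 ^ U.card * Real.exp (x ^ 2 * S.card - x * δ) := by
  set X : Finset α → ℝ := fun E => ((S.filter fun i => e i ∈ E ∧ f i ∈ E).card : ℝ) - S.card / 4
  have h1 := sum_powerset_exp_le (x := x) (by rwa [abs_of_nonneg hx0]) e f S U hU he hf hef
  have h2 := sum_powerset_exp_le (x := -x) (by rwa [abs_neg, abs_of_nonneg hx0]) e f S U hU he hf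
    hef
  rw [neg_sq] at h2
  -- Markov's inequality, with both signs of `x` to cover both tails.
  have h3 : ((U.powerset.filter fun E => δ ≤ |X E|).card : ℝ) * Real.exp (x * δ) ≤
      ∑ E ∈ U.powerset, (Real.exp (x * X E) + Real.exp (-x * X E)) := by
    rw [← nsmul_eq_mul, ← Finset.sum_const]
    refine (Finset.sum_le_sum fun E hE => ?_).trans
      (Finset.sum_le_sum_of_subset_of_nonneg (Finset.filter_subset _ _) fun E _ _ => by positivity)
    have hE' := (Finset.mem_filter.1 hE).2
    rcases le_abs.1 hE' with h | h
    · have : Real.exp (x * δ) ≤ Real.exp (x * X E) := Real.exp_le_exp.2 (by gcongr)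
      have := Real.exp_pos (-x * X E)
      linarith
    · have : Real.exp (x * δ) ≤ Real.exp (-x * X E) := Real.exp_le_exp.2 (by nlinarith)
      have := Real.exp_pos (x * X E)
      linarith
  rw [Finset.sum_add_distrib] at h3
  rw [Real.exp_sub, ← mul_div_assoc, le_div_iff₀ (Real.exp_pos _)]
  linarith

end Moment

/-! ### Binomial coefficients -/

/-- Disjoint sets of sizes `x` and `y` have no common `m`-subset; this fails for `m = 0`, where the
empty set is shared. -/
theorem choose_add_choose_le {x y m : ℕ} (hm : 0 < m) :
    x.choose m + y.choose m ≤ (x + y).choose m := by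
  induction y with
  | zero => simp [Nat.choose_eq_zero_of_lt hm]
  | succ y ih =>
    obtain ⟨m, rfl⟩ := Nat.exists_eq_succ_of_ne_zero hm.ne'
    have : y.choose m ≤ (x + y).choose m := Nat.choose_le_choose m (by omega)
    rw [← add_assoc, Nat.choose_succ_succ (x + y), Nat.choose_succ_succ y]
    simp only [Nat.succ_eq_add_one] at ih ⊢
    omega

/-- The binomial coefficient grows like `n ^ m`, so it beats every linear function once `m ≥ 2`.
This is where `k ≥ 3` enters. -/
theorem eventually_mul_le_choose (m K : ℕ) (hm : 2 ≤ m) :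
    ∀ᶠ n : ℕ in atTop, K * n ≤ (n / 4).choose m := by
  filter_upwards [eventually_ge_atTop (64 * (K * m.factorial + m + 1))] with n hn
  set y := n / 4 + 1 - m with hy
  have h1 : n ≤ 8 * y := by omega
  have h2 : 8 * (K * m.factorial) ≤ y := by omega
  have h3 : y ^ 2 ≤ y ^ m := Nat.pow_le_pow_right (by omega) hm
  refine Nat.le_of_mul_le_mul_left (?_ : m.factorial * (K * n) ≤ m.factorial * _)
    m.factorial_pos
  have h' : y ^ m ≤ m.factorial * (n / 4).choose m := by
    rw [← Nat.descFactorial_eq_factorial_mul_choose]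
    exact Nat.pow_sub_le_descFactorial _ _
  calc m.factorial * (K * n) ≤ m.factorial * (K * (8 * y)) := by gcongr
    _ = 8 * (K * m.factorial) * y := by ring
    _ ≤ y * y := by gcongr
    _ = y ^ 2 := by ring
    _ ≤ _ := h3.trans h'

/-- Both sides have order `n ^ m`: the number of bridges is at most a constant times the gap, so
deviations of the size of the gap are exponentially rare. -/
theorem eventually_choose_le_mul_choose (m : ℕ) :
    ∀ᶠ n : ℕ in atTop, (n - 2).choose m ≤ 8 ^ m * (n / 4).choose m := by
  filter_upwards [eventually_ge_atTop (64 * (m + 1))] with n hn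
  set y := n / 4 + 1 - m with hy
  have h1 : n ≤ 8 * y := by omega
  have h' : y ^ m ≤ m.factorial * (n / 4).choose m := by
    rw [← Nat.descFactorial_eq_factorial_mul_choose]
    exact Nat.pow_sub_le_descFactorial _ _
  refine Nat.le_of_mul_le_mul_left (?_ : m.factorial * _ ≤ m.factorial * _) m.factorial_pos
  calc m.factorial * (n - 2).choose m = (n - 2).descFactorial m :=
        (Nat.descFactorial_eq_factorial_mul_choose _ _).symm
    _ ≤ (n - 2) ^ m := Nat.descFactorial_le_pow _ _
    _ ≤ (8 * y) ^ m := Nat.pow_le_pow_left (by omega) _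
    _ = 8 ^ m * y ^ m := mul_pow _ _ _
    _ ≤ 8 ^ m * (m.factorial * (n / 4).choose m) := by gcongr
    _ = _ := by ring

namespace KGraph

/-! ### Hypergraphs with a given colouring -/

section Crossing

variable {V : Type*} [Fintype V] {k m : ℕ} {c : V → Bool}

/-- The `k`-sets that are not monochromatic. -/
def crossing (k : ℕ) (c : V → Bool) : Finset (Finset V) :=
  (Finset.univ.powersetCard k).filter fun e => ∃ u ∈ e, ∃ v ∈ e, c u ≠ c v

def colorClass (c : V → Bool) (b : Bool) : Finset V := Finset.univ.filter fun v => c v = b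

theorem mem_colorClass {b : Bool} {v : V} : v ∈ colorClass c b ↔ c v = b := by
  simp [colorClass]

theorem isTwoColoring_iff (H : KGraph k V) : H.IsTwoColoring c ↔ H.edges ⊆ crossing k c := by
  constructor
  · intro h e he
    exact Finset.mem_filter.2 ⟨Finset.mem_powersetCard.2 ⟨Finset.subset_univ _, H.sized he⟩, h e he⟩
  · intro h e he
    exact (Finset.mem_filter.1 (h he)).2

open Classical in
theorem card_filter_isTwoColoring (c : V → Bool) (p : Finset (Finset V) → Prop) :
    (Finset.univ.filter fun H : KGraph k V => H.IsTwoColoring c ∧ p H.edges).card =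
      ((crossing k c).powerset.filter p).card := by
  refine Finset.card_bij (fun H _ => H.edges) ?_ ?_ ?_
  · intro H hH
    rw [Finset.mem_filter, isTwoColoring_iff] at hH
    exact Finset.mem_filter.2 ⟨Finset.mem_powerset.2 hH.2.1, hH.2.2⟩
  · rintro ⟨E, hE⟩ _ ⟨E', hE'⟩ _ rfl
    rfl
  · intro E hE
    rw [Finset.mem_filter, Finset.mem_powerset] at hE
    refine ⟨⟨E, fun e he => ?_⟩, ?_, rfl⟩
    · exact (Finset.mem_powersetCard.1 (Finset.mem_filter.1 (hE.1 he)).1).2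
    · rw [Finset.mem_filter, isTwoColoring_iff]
      exact ⟨Finset.mem_univ _, hE⟩

/-- Every set of crossing `k`-sets is the edge set of a hypergraph legally coloured by `c`. -/
theorem two_pow_card_crossing_le {n : ℕ} (c : Fin n → Bool) :
    2 ^ (crossing k c).card ≤ (twoColorable k n).card := by
  classical
  have h := card_filter_isTwoColoring (k := k) c (fun _ => True)
  simp only [and_true, Finset.filter_true, Finset.card_powerset] at h
  rw [← h]
  refine Finset.card_le_card fun H hH => ?_
  rw [Finset.mem_filter] at hH
  exact Finset.mem_filter.2 ⟨hH.1, c, hH.2⟩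

theorem mem_crossing_iff {e : Finset V} (he : e.card = k) (he0 : 0 < k) :
    e ∈ crossing k c ↔ ∀ b, ¬ e ⊆ colorClass c b := by
  have h1 : e ∈ crossing k c ↔ ∃ u ∈ e, ∃ v ∈ e, c u ≠ c v := by
    simp [crossing, he]
  rw [h1]
  constructor
  · rintro ⟨u, hu, v, hv, h⟩ b hb
    exact h ((mem_colorClass.1 (hb hu)).trans (mem_colorClass.1 (hb hv)).symm)
  · intro h
    obtain ⟨u, hu⟩ := Finset.card_pos.1 (he ▸ he0)
    obtain ⟨v, hv, hne⟩ := Finset.not_subset.1 (h (c u))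
    exact ⟨u, hu, v, hv, fun h' => hne (mem_colorClass.2 h'.symm)⟩

variable [DecidableEq V]

theorem card_colorClass_add (c : V → Bool) (b : Bool) :
    (colorClass c b).card + (colorClass c !b).card = Fintype.card V := by
  have : colorClass c (!b) = (colorClass c b)ᶜ := by
    ext v
    simp only [Finset.mem_compl, mem_colorClass]
    cases c v <;> cases b <;> simp
  rw [this, Finset.card_add_card_compl]

theorem card_crossing_add (hk : 0 < k) (c : V → Bool) (b : Bool) :
    (crossing k c).card + ((colorClass c b).card.choose k + (colorClass c !b).card.choose k) =
      (Fintype.card V).choose k := by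
  have hd : Disjoint ((colorClass c b).powersetCard k) ((colorClass c !b).powersetCard k) := by
    rw [Finset.disjoint_left]
    intro e h1 h2
    rw [Finset.mem_powersetCard] at h1 h2
    obtain ⟨u, hu⟩ := Finset.card_pos.1 (h1.2 ▸ hk)
    have e1 := mem_colorClass.1 (h1.1 hu)
    have e2 := mem_colorClass.1 (h2.1 hu)
    rw [e1] at e2
    simp at e2
  rw [← Finset.card_powersetCard, ← Finset.card_powersetCard, ← Finset.card_union_of_disjoint hd,
    ← Finset.card_union_of_disjoint, ← Finset.card_univ, ← Finset.card_powersetCard]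
  · congr 1
    ext e
    by_cases he : e.card = k
    · rw [Finset.mem_union, mem_crossing_iff he hk]
      simp only [Finset.mem_union, Finset.mem_powersetCard, he, and_true, Finset.subset_univ,
        iff_true]
      cases b <;> simp only [Bool.forall_bool, Bool.not_true, Bool.not_false] <;> tauto
    · simp [crossing, he]
  · rw [Finset.disjoint_left]
    intro e h1 h2
    have he : e.card = k := by
      rw [crossing, Finset.mem_filter, Finset.mem_powersetCard] at h1
      exact h1.1.2
    rw [mem_crossing_iff he hk] at h1
    rw [Finset.mem_union, Finset.mem_powersetCard, Finset.mem_powersetCard] at h2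
    rcases h2 with h2 | h2
    · exact h1 _ h2.1
    · exact h1 _ h2.1

/-- If one of the colour classes is small, then moving a vertex to it creates many crossing
edges. -/
theorem exists_card_crossing_ge (hk : 1 < k) (c : V → Bool) (b : Bool)
    (hb : 4 * (colorClass c b).card ≤ Fintype.card V) (hV : 4 ≤ Fintype.card V) :
    ∃ c' : V → Bool, (crossing k c).card + (Fintype.card V / 4).choose (k - 1) ≤
      (crossing k c').card := by
  have hsum := card_colorClass_add c b
  obtain ⟨v, hv⟩ : (colorClass c !b).Nonempty := Finset.card_pos.1 (by omega)
  refine ⟨Function.update c v b, ?_⟩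
  have hv' := mem_colorClass.1 hv
  have h1 : colorClass (Function.update c v b) b = insert v (colorClass c b) := by
    ext u
    rw [mem_colorClass, Finset.mem_insert, mem_colorClass, Function.update_apply]
    split_ifs with h <;> simp [h]
  have h2 : colorClass (Function.update c v b) (!b) = (colorClass c (!b)).erase v := by
    ext u
    rw [mem_colorClass, Finset.mem_erase, mem_colorClass, Function.update_apply]
    split_ifs with h <;> simp [h]
  have hvb : v ∉ colorClass c b := by
    rw [mem_colorClass, hv']
    simp
  have e1 := card_crossing_add (by omega : 0 < k) c b
  have e2 := card_crossing_add (by omega : 0 < k) (Function.update c v b) b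
  rw [h1, h2, Finset.card_insert_of_notMem hvb, Finset.card_erase_of_mem hv] at e2
  set x := (colorClass c b).card
  set y := (colorClass c !b).card
  obtain ⟨m, rfl⟩ : ∃ m, k = m + 1 := ⟨k - 1, by omega⟩
  obtain ⟨z, hz⟩ : ∃ z, y = z + 1 := ⟨y - 1, by omega⟩
  rw [hz, Nat.choose_succ_succ] at e1
  rw [hz, Nat.choose_succ_succ] at e2
  simp only [Nat.succ_eq_add_one, Nat.add_sub_cancel] at e1 e2 ⊢
  -- By Pascal's rule the move gains `z.choose m - x.choose m` crossing sets. Superadditivity at `z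
  -- = x + (z - x)` bounds this below by `(z - x).choose m`, and `x` is at most a quarter of all
  -- vertices.
  have e3 := choose_add_choose_le (x := x) (y := z - x) (m := m) (by omega)
  rw [show x + (z - x) = z by omega] at e3
  have e4 : (Fintype.card V / 4).choose m ≤ (z - x).choose m :=
    Nat.choose_le_choose m (by omega)
  omega

/-! ### Codegrees -/

/-- The number of `m`-sets that form an edge of `E` together with `o` as well as with `u`. -/
def codegree (m : ℕ) (E : Finset (Finset V)) (o u : V) : ℕ :=
  (({o, u}ᶜ : Finset V).powersetCard m |>.filter fun W => insert o W ∈ E ∧ insert u W ∈ E).card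

/-- The `m`-sets that can form an edge with `o` as well as with `u`. -/
def bridges (m : ℕ) (c : V → Bool) (o u : V) : Finset (Finset V) :=
  ({o, u}ᶜ : Finset V).powersetCard m |>.filter fun W =>
    insert o W ∈ crossing (m + 1) c ∧ insert u W ∈ crossing (m + 1) c

variable {o u : V}

theorem mem_powersetCard_compl_pair {W : Finset V} :
    W ∈ ({o, u}ᶜ : Finset V).powersetCard m ↔ o ∉ W ∧ u ∉ W ∧ W.card = m := by
  rw [Finset.mem_powersetCard, Finset.subset_compl_iff_disjoint_right, ← and_assoc]
  simp

theorem codegree_eq {E : Finset (Finset V)} (hE : E ⊆ crossing (m + 1) c) (o u : V) :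
    codegree m E o u =
      ((bridges m c o u).filter fun W => insert o W ∈ E ∧ insert u W ∈ E).card := by
  rw [codegree, bridges, Finset.filter_filter]
  congr 1
  refine Finset.filter_congr fun W _ => ?_
  constructor
  · exact fun h => ⟨⟨hE h.1, hE h.2⟩, h⟩
  · exact fun h => h.2

/-- The pairs `insert o W`, `insert u W` over all bridges `W` are disjoint: sets of the first kind
contain `o`, those of the second do not, and erasing the added vertex recovers `W`. -/
theorem card_codegree_deviation_le {x δ : ℝ} (hx0 : 0 ≤ x) (hx : x ≤ 1) (c : V → Bool)
    (hou : o ≠ u) :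
    ((((crossing (m + 1) c).powerset.filter fun E =>
      δ ≤ |(codegree m E o u : ℝ) - (bridges m c o u).card / 4|).card : ℕ) : ℝ) ≤
      2 * 2 ^ (crossing (m + 1) c).card *
        Real.exp (x ^ 2 * (bridges m c o u).card - x * δ) := by
  have h := card_deviation_le (δ := δ) hx0 hx (fun W => insert o W) (fun W => insert u W)
    (bridges m c o u) (crossing (m + 1) c) ?_ ?_ ?_ ?_
  · refine le_trans (le_of_eq ?_) h
    congr 2
    refine Finset.filter_congr fun E hE => ?_
    rw [codegree_eq (Finset.mem_powerset.1 hE)]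
  · intro W hW
    exact (Finset.mem_filter.1 hW).2
  · intro W hW W' hW' h
    have h1 := (mem_powersetCard_compl_pair.1 (Finset.mem_filter.1 hW).1).1
    have h2 := (mem_powersetCard_compl_pair.1 (Finset.mem_filter.1 hW').1).1
    rw [← Finset.erase_insert h1, ← Finset.erase_insert h2]
    exact congrArg (fun A => Finset.erase A o) h
  · intro W hW W' hW' h
    have h1 := (mem_powersetCard_compl_pair.1 (Finset.mem_filter.1 hW).1).2.1
    have h2 := (mem_powersetCard_compl_pair.1 (Finset.mem_filter.1 hW').1).2.1
    rw [← Finset.erase_insert h1, ← Finset.erase_insert h2]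
    exact congrArg (fun A => Finset.erase A u) h
  · intro W hW W' hW' h
    have h2 := (mem_powersetCard_compl_pair.1 (Finset.mem_filter.1 hW').1).1
    have : o ∈ insert u W' := h ▸ Finset.mem_insert_self o W
    rcases Finset.mem_insert.1 this with h' | h'
    · exact hou h'
    · exact h2 h'

theorem insert_mem_crossing_iff {W : Finset V} {v : V} (hm : 0 < m) (hW : W.card = m)
    (hv : v ∉ W) : insert v W ∈ crossing (m + 1) c ↔ ¬ W ⊆ colorClass c (c v) := by
  rw [mem_crossing_iff (by rw [Finset.card_insert_of_notMem hv, hW]) (by omega)]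
  constructor
  · exact fun h h' => h (c v) (Finset.insert_subset (mem_colorClass.2 rfl) h')
  · intro h b hb
    have : c v = b := mem_colorClass.1 (hb (Finset.mem_insert_self v W))
    exact h (this ▸ (Finset.subset_insert v W).trans hb)

theorem card_bridges_le (hou : o ≠ u) :
    (bridges m c o u).card ≤ (Fintype.card V - 2).choose m := by
  refine (Finset.card_filter_le _ _).trans ?_
  rw [Finset.card_powersetCard, Finset.card_compl, Finset.card_pair hou]

/-- For equal colours an `m`-set fails to be a bridge only if it lies in the common class. -/
theorem card_bridges_of_eq (hm : 0 < m) (hou : o ≠ u) (h : c o = c u) :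
    (bridges m c o u).card + ((colorClass c (c o)).card - 2).choose m =
      (Fintype.card V - 2).choose m := by
  have h1 : (Fintype.card V - 2).choose m = (({o, u}ᶜ : Finset V).powersetCard m).card := by
    rw [Finset.card_powersetCard, Finset.card_compl, Finset.card_pair hou]
  have h2 : ((colorClass c (c o)).card - 2).choose m =
      ((colorClass c (c o) \ {o, u}).powersetCard m).card := by
    rw [Finset.card_powersetCard, Finset.card_sdiff_of_subset, Finset.card_pair hou]
    intro v hv
    rw [mem_colorClass]
    rcases Finset.mem_insert.1 hv with rfl | hv
    · rfl
    · rw [Finset.mem_singleton.1 hv, h]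
  rw [h1, h2, ← Finset.card_union_of_disjoint]
  · congr 1
    ext W
    rw [Finset.mem_union, bridges, Finset.mem_filter, mem_powersetCard_compl_pair,
      Finset.mem_powersetCard, Finset.subset_sdiff, Finset.disjoint_insert_right,
      Finset.disjoint_singleton_right]
    by_cases hW : o ∉ W ∧ u ∉ W ∧ W.card = m
    · rw [insert_mem_crossing_iff hm hW.2.2 hW.1, insert_mem_crossing_iff hm hW.2.2 hW.2.1, ← h]
      tauto
    · tauto
  · rw [Finset.disjoint_left]
    intro W h3 h4
    rw [bridges, Finset.mem_filter, mem_powersetCard_compl_pair] at h3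
    rw [Finset.mem_powersetCard, Finset.subset_sdiff] at h4
    exact (insert_mem_crossing_iff hm h4.2 h3.1.1).1 h3.2.1 h4.1.1

/-- For different colours an `m`-set inside either class fails. These two kinds of failure exclude
each other, so the second class accounts for the gap to the case of equal colours. -/
theorem card_bridges_of_ne (hm : 0 < m) (h : c o ≠ c u) :
    (bridges m c o u).card + (((colorClass c (c o)).card - 1).choose m +
      ((colorClass c (c u)).card - 1).choose m) = (Fintype.card V - 2).choose m := by
  have hou : o ≠ u := fun h' => h (h' ▸ rfl)
  have h1 : (Fintype.card V - 2).choose m = (({o, u}ᶜ : Finset V).powersetCard m).card := by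
    rw [Finset.card_powersetCard, Finset.card_compl, Finset.card_pair hou]
  have h2 : ∀ v, ((colorClass c (c v)).card - 1).choose m =
      (((colorClass c (c v)).erase v).powersetCard m).card := by
    intro v
    rw [Finset.card_powersetCard, Finset.card_erase_of_mem (mem_colorClass.2 rfl)]
  rw [h1, h2, h2, ← Finset.card_union_of_disjoint, ← Finset.card_union_of_disjoint]
  · congr 1
    ext W
    rw [Finset.mem_union, Finset.mem_union, bridges, Finset.mem_filter,
      mem_powersetCard_compl_pair, Finset.mem_powersetCard, Finset.subset_erase,
      Finset.mem_powersetCard, Finset.subset_erase]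
    have n1 : W ⊆ colorClass c (c o) → u ∉ W := fun h' hu => h (mem_colorClass.1 (h' hu)).symm
    have n2 : W ⊆ colorClass c (c u) → o ∉ W := fun h' hu => h (mem_colorClass.1 (h' hu))
    by_cases hW : o ∉ W ∧ u ∉ W ∧ W.card = m
    · rw [insert_mem_crossing_iff hm hW.2.2 hW.1, insert_mem_crossing_iff hm hW.2.2 hW.2.1]
      tauto
    · tauto
  · rw [Finset.disjoint_left]
    intro W h3 h4
    rw [bridges, Finset.mem_filter, mem_powersetCard_compl_pair] at h3
    rw [Finset.mem_union, Finset.mem_powersetCard, Finset.subset_erase, Finset.mem_powersetCard,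
      Finset.subset_erase] at h4
    rcases h4 with h4 | h4
    · exact (insert_mem_crossing_iff hm h4.2 h3.1.1).1 h3.2.1 h4.1.1
    · exact (insert_mem_crossing_iff hm h4.2 h3.1.2.1).1 h3.2.2 h4.1.1
  · rw [Finset.disjoint_left]
    intro W h3 h4
    rw [Finset.mem_powersetCard, Finset.subset_erase] at h3 h4
    obtain ⟨v, hv⟩ := Finset.card_pos.1 (h3.2 ▸ hm)
    exact h ((mem_colorClass.1 (h3.1.1 hv)).symm.trans (mem_colorClass.1 (h4.1.1 hv)))

/-- The codegrees with `o` tell the vertices of the colour of `o` from the other ones. -/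
def Separates (m : ℕ) (E : Finset (Finset V)) (c : V → Bool) (o : V) : Prop :=
  ∀ u v, u ≠ o → c u = c o → c v ≠ c o → codegree m E o v < codegree m E o u

/-- The expected codegrees of the two colours differ by at least a quarter of `(n/4).choose m`,
where `n` is the number of vertices, so errors below an eighth on each side cannot reverse the
order. -/
theorem separates_of_abs_lt {E : Finset (Finset V)} {o : V} (hm : 0 < m)
    (hc : ∀ b, Fintype.card V < 4 * (colorClass c b).card)
    (h : ∀ u ≠ o, |(codegree m E o u : ℝ) - (bridges m c o u).card / 4| <
      (Fintype.card V / 4).choose m / 8) : Separates m E c o := by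
  intro u v huo hu hv
  have h1 := (abs_lt.1 (h u huo)).1
  have h2 := (abs_lt.1 (h v (fun h' => hv (h' ▸ rfl)))).2
  have e1 := card_bridges_of_eq hm huo.symm hu.symm
  have e2 := card_bridges_of_ne hm hv.symm
  have e3 : ((colorClass c (c o)).card - 2).choose m ≤ ((colorClass c (c o)).card - 1).choose m :=
    Nat.choose_le_choose m (by omega)
  have e4 : (Fintype.card V / 4).choose m ≤ ((colorClass c (c v)).card - 1).choose m :=
    Nat.choose_le_choose m (by have := hc (c v); omega)
  have e5 : (bridges m c o v).card + (Fintype.card V / 4).choose m ≤ (bridges m c o u).card := by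
    omega
  have e6 : ((bridges m c o v).card : ℝ) + (Fintype.card V / 4).choose m ≤
      (bridges m c o u).card := by exact_mod_cast e5
  have : (codegree m E o v : ℝ) < codegree m E o u := by linarith
  exact_mod_cast this

end Crossing

/-! ### Rarity of hypergraphs without a recognizable colouring -/

open Classical in
/-- In most hypergraphs with a balanced colouring `c` the codegrees separate the colours. -/
theorem eventually_card_not_separates_le (m : ℕ) (hm : 2 ≤ m) :
    ∀ᶠ n : ℕ in atTop, ∀ (c : Fin n → Bool) (o : Fin n),
      (∀ b, n < 4 * (colorClass c b).card) →
      (((crossing (m + 1) c).powerset.filter fun E => ¬ Separates m E c o).card : ℝ) * 16 ^ n ≤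
        n * 2 ^ (crossing (m + 1) c).card := by
  filter_upwards [eventually_choose_le_mul_choose m,
    eventually_mul_le_choose m (256 * 8 ^ m * 4) hm, eventually_ge_atTop 1] with n h1 h2 hn c o hc
  set G : ℕ := (n / 4).choose m with hG
  -- Chosen so that, with at most `8 ^ m * G` bridges, the quadratic term is at most `x * G / 16`,
  -- half of the gain `x * G / 8`. Since `x * G ≥ 64 * n`, an exponent of at most `-4 * n` remains.
  set x : ℝ := 1 / (16 * 8 ^ m) with hx
  have hx0 : 0 ≤ x := by positivity
  have h8 : (1 : ℝ) ≤ 8 ^ m := one_le_pow₀ (by norm_num)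
  have hx1 : x ≤ 1 := by
    rw [hx, div_le_one (by positivity)]
    linarith
  have hsub : (crossing (m + 1) c).powerset.filter (fun E => ¬ Separates m E c o) ⊆
      (Finset.univ.erase o).biUnion fun u => (crossing (m + 1) c).powerset.filter fun E =>
        (G : ℝ) / 8 ≤ |(codegree m E o u : ℝ) - (bridges m c o u).card / 4| := by
    intro E hE
    rw [Finset.mem_filter] at hE
    by_contra hcon
    refine hE.2 (separates_of_abs_lt (by omega) (by simpa using hc) fun u hu => ?_)
    by_contra hlt
    refine hcon (Finset.mem_biUnion.2 ⟨u, by simpa using hu, Finset.mem_filter.2 ⟨hE.1, ?_⟩⟩)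
    simpa using hlt
  have hu : ∀ u ∈ Finset.univ.erase o, ((((crossing (m + 1) c).powerset.filter fun E =>
      (G : ℝ) / 8 ≤ |(codegree m E o u : ℝ) - (bridges m c o u).card / 4|).card : ℕ) : ℝ) ≤
      2 ^ (crossing (m + 1) c).card / 16 ^ n := by
    intro u hu
    have hou : o ≠ u := (Finset.ne_of_mem_erase hu).symm
    refine (card_codegree_deviation_le hx0 hx1 c hou).trans ?_
    have hB : ((bridges m c o u).card : ℝ) ≤ 8 ^ m * G := by
      have := card_bridges_le (m := m) (c := c) hou
      rw [Fintype.card_fin] at this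
      exact_mod_cast this.trans h1
    have hGn : (256 * 8 ^ m * 4 : ℝ) * n ≤ G := by exact_mod_cast h2
    have hexp : x ^ 2 * (bridges m c o u).card - x * (G / 8) ≤ -(4 * n) := by
      have h3 : x ^ 2 * (bridges m c o u).card ≤ x * G / 16 := by
        calc x ^ 2 * (bridges m c o u).card ≤ x ^ 2 * (8 ^ m * G) := by gcongr
          _ = _ := by rw [hx]; field_simp
      have h4 : 64 * (n : ℝ) ≤ x * G := by
        calc 64 * (n : ℝ) = x * (256 * 8 ^ m * 4 * n) := by rw [hx]; field_simp; norm_num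
          _ ≤ _ := by gcongr
      linarith
    -- It suffices that `exp 4 > 32`, as the factor 2 is at most `2 ^ n`.
    have h16 : 2 * Real.exp (-(4 * n)) ≤ 1 / 16 ^ n := by
      rw [Real.exp_neg, ← div_eq_mul_inv, div_le_div_iff₀ (Real.exp_pos _) (by positivity), one_mul]
      have he : (2.7 : ℝ) ≤ Real.exp 1 := by
        have := Real.exp_one_gt_d9
        linarith
      have : Real.exp (4 * n) = (Real.exp 1 ^ 4) ^ n := by
        rw [← pow_mul, ← Real.exp_nat_mul]
        push_cast
        ring_nf
      rw [this]
      have h32 : (32 : ℝ) ≤ Real.exp 1 ^ 4 := by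
        calc (32 : ℝ) ≤ 2.7 ^ 4 := by norm_num
          _ ≤ _ := by gcongr
      calc 2 * (16 : ℝ) ^ n ≤ 2 ^ n * 16 ^ n := by
            gcongr
            exact le_self_pow₀ (by norm_num) (by omega)
        _ = 32 ^ n := by rw [← mul_pow]; norm_num
        _ ≤ _ := by gcongr
    calc 2 * 2 ^ (crossing (m + 1) c).card *
        Real.exp (x ^ 2 * (bridges m c o u).card - x * (G / 8))
        ≤ 2 * 2 ^ (crossing (m + 1) c).card * Real.exp (-(4 * n)) := by gcongr
      _ = 2 ^ (crossing (m + 1) c).card * (2 * Real.exp (-(4 * n))) := by ring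
      _ ≤ 2 ^ (crossing (m + 1) c).card * (1 / 16 ^ n) := by gcongr
      _ = _ := by ring
  have h3 : (((crossing (m + 1) c).powerset.filter fun E => ¬ Separates m E c o).card : ℝ) ≤
      n * (2 ^ (crossing (m + 1) c).card / 16 ^ n) := by
    calc _ ≤ (∑ u ∈ Finset.univ.erase o, ((((crossing (m + 1) c).powerset.filter fun E =>
      (G : ℝ) / 8 ≤ |(codegree m E o u : ℝ) - (bridges m c o u).card / 4|).card : ℕ) : ℝ)) := by
          exact_mod_cast (Finset.card_le_card hsub).trans Finset.card_biUnion_le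
      _ ≤ _ := Finset.sum_le_sum hu
      _ ≤ _ := by
          rw [Finset.sum_const, nsmul_eq_mul]
          gcongr
          exact (Finset.card_le_univ _).trans (by simp)
  calc _ ≤ (n : ℝ) * (2 ^ (crossing (m + 1) c).card / 16 ^ n) * 16 ^ n := by gcongr
    _ = _ := by field_simp

/-- The colouring `c` has large colour classes, and the codegrees with `o` separate them. -/
def Recognizable {n : ℕ} (m : ℕ) (E : Finset (Finset (Fin n))) (c : Fin n → Bool)
    (o : Fin n) : Prop :=
  (∀ b, n < 4 * (colorClass c b).card) ∧ Separates m E c o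

open Classical in
/-- Few 2-colourable hypergraphs have no recognizable colouring. -/
theorem eventually_card_not_recognizable_le (m : ℕ) (hm : 2 ≤ m) :
    ∀ᶠ n : ℕ in atTop, ∀ o : Fin n,
      (((twoColorable (m + 1) n).filter fun H =>
        ¬ ∃ c, H.IsTwoColoring c ∧ Recognizable m H.edges c o).card : ℝ) * 8 ^ n ≤
        n * (twoColorable (m + 1) n).card := by
  filter_upwards [eventually_card_not_separates_le m hm, eventually_mul_le_choose m 4 hm,
    eventually_ge_atTop 4] with n h1 h2 hn o
  set N := (twoColorable (m + 1) n).card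
  have hsub : ((twoColorable (m + 1) n).filter fun H =>
        ¬ ∃ c, H.IsTwoColoring c ∧ Recognizable m H.edges c o) ⊆
      (Finset.univ : Finset (Fin n → Bool)).biUnion fun c =>
        Finset.univ.filter fun H : KGraph (m + 1) (Fin n) =>
          H.IsTwoColoring c ∧ ¬ Recognizable m H.edges c o := by
    intro H hH
    rw [Finset.mem_filter, twoColorable, Finset.mem_filter] at hH
    obtain ⟨⟨-, c, hc⟩, h⟩ := hH
    refine Finset.mem_biUnion.2 ⟨c, Finset.mem_univ _, Finset.mem_filter.2 ⟨Finset.mem_univ _, hc, ?_⟩⟩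
    exact fun h' => h ⟨c, hc, h'⟩
  have hc : ∀ c : Fin n → Bool, ((Finset.univ.filter fun H : KGraph (m + 1) (Fin n) =>
          H.IsTwoColoring c ∧ ¬ Recognizable m H.edges c o).card : ℝ) ≤ n * N / 16 ^ n := by
    intro c
    have h0 : (Finset.univ.filter fun H : KGraph (m + 1) (Fin n) =>
        H.IsTwoColoring c ∧ ¬ Recognizable m H.edges c o).card =
        ((crossing (m + 1) c).powerset.filter fun E => ¬ Recognizable m E c o).card := by
      convert card_filter_isTwoColoring c (fun E => ¬ Recognizable m E c o)
    rw [h0, le_div_iff₀ (by positivity)]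
    by_cases hb : ∀ b, n < 4 * (colorClass c b).card
    · have : (crossing (m + 1) c).powerset.filter (fun E => ¬ Recognizable m E c o) =
          (crossing (m + 1) c).powerset.filter (fun E => ¬ Separates m E c o) := by
        refine Finset.filter_congr fun E _ => ?_
        simp [Recognizable, hb]
      rw [this]
      refine (h1 c o hb).trans ?_
      gcongr
      exact_mod_cast two_pow_card_crossing_le c
    -- For an unbalanced `c` even the total number of its hypergraphs is negligible: another
    -- colouring has at least `4 * n` more crossing sets, hence `16 ^ n` times as many hypergraphs.
    · push Not at hb
      obtain ⟨b, hb⟩ := hb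
      obtain ⟨c', hc'⟩ := exists_card_crossing_ge (k := m + 1) (by omega) c b (by simpa using hb)
        (by simpa using hn)
      rw [Nat.add_sub_cancel, Fintype.card_fin] at hc'
      have h3 : ((crossing (m + 1) c).powerset.filter (fun E => ¬ Recognizable m E c o)).card ≤
          2 ^ (crossing (m + 1) c).card := by
        rw [← Finset.card_powerset]
        exact Finset.card_filter_le _ _
      have h4 : ((crossing (m + 1) c).powerset.filter
          (fun E => ¬ Recognizable m E c o)).card * 16 ^ n ≤ n * N := by
        calc _ ≤ 2 ^ (crossing (m + 1) c).card * 16 ^ n := by gcongr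
          _ = 2 ^ ((crossing (m + 1) c).card + 4 * n) := by
              rw [pow_add, pow_mul]; norm_num
          _ ≤ 2 ^ (crossing (m + 1) c').card := Nat.pow_le_pow_right (by norm_num) (by omega)
          _ ≤ N := two_pow_card_crossing_le c'
          _ ≤ n * N := Nat.le_mul_of_pos_left _ (by omega)
      exact_mod_cast h4
  have h3 : (((twoColorable (m + 1) n).filter fun H =>
        ¬ ∃ c, H.IsTwoColoring c ∧ Recognizable m H.edges c o).card : ℝ) ≤
        2 ^ n * (n * N / 16 ^ n) := by
    calc _ ≤ ∑ c : Fin n → Bool, ((Finset.univ.filter fun H : KGraph (m + 1) (Fin n) =>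
          H.IsTwoColoring c ∧ ¬ Recognizable m H.edges c o).card : ℝ) := by
          exact_mod_cast (Finset.card_le_card hsub).trans Finset.card_biUnion_le
      _ ≤ ∑ c : Fin n → Bool, (n * N / 16 ^ n : ℝ) := Finset.sum_le_sum fun c _ => hc c
      _ = _ := by simp
  calc _ ≤ (2 : ℝ) ^ n * (n * N / 16 ^ n) * 8 ^ n := by gcongr
    _ = n * N * ((2 : ℝ) ^ n * 8 ^ n / 16 ^ n) := by ring
    _ = _ := by
      rw [← mul_pow]
      norm_num

end KGraph

namespace KGraph

/-! ### Edge queries -/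

section Queries

variable {k m n : ℕ}

theorem ask_iff (H : KGraph k (Fin n)) (v : Fin k → Fin n) :
    H.ask (fun i => (v i : ℕ)) = true ↔ Finset.univ.image v ∈ H.edges := by
  have h : Finset.univ.image (fun i => (v i : ℕ)) =
      (Finset.univ.image v).map Fin.valEmbedding := by
    ext x
    simp
  rw [ask, decide_eq_true_iff, h]
  constructor
  · rintro ⟨e, he, h'⟩
    rwa [← Finset.map_injective _ h']
  · exact fun h' => ⟨_, h', rfl⟩

/-- Every edge is enumerated by some tuple, whose colour sum would be `0` or `k` if the edge were
monochromatic. -/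
theorem isTwoColoring_of_legal {H : KGraph k (Fin n)} {f : ℕ → ℕ} (hf1 : ∀ m < n, f m ≤ 1)
    (hf : Program.Legal H.ask n f) : H.IsTwoColoring fun v => decide (f v = 1) := by
  intro e he
  by_contra! hcon
  have hcard : e.card = k := H.sized he
  obtain ⟨v, rfl⟩ : ∃ v : Fin k → Fin n, Finset.univ.image v = e := by
    refine ⟨fun i => ((e.equivFinOfCardEq hcard).symm i : Fin n), ?_⟩
    ext x
    simp only [Finset.mem_image, Finset.mem_univ, true_and]
    constructor
    · rintro ⟨i, rfl⟩
      exact Subtype.prop _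
    · exact fun hx => ⟨e.equivFinOfCardEq hcard ⟨x, hx⟩, by simp⟩
  obtain ⟨j, hj, hv⟩ := Program.exists_digits v
  have hq : H.ask (fun i => j / n ^ (i : ℕ) % n) = true := by
    simp only [hv]
    exact (ask_iff H v).2 he
  obtain ⟨h0, h1⟩ := hf j hj hq
  rw [Finset.sum_range] at h0 h1
  simp only [hv] at h0 h1
  obtain ⟨i, hi⟩ : ∃ i, f (v i) ≠ 0 := by
    by_contra! h
    simp [h] at h0
  have hall : ∀ i', f (v i') = 1 := by
    intro i'
    have h2 := hcon (v i) (by simp) (v i') (by simp)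
    have h3 : f (v i) = 1 := by have := hf1 (v i) (v i).2; omega
    simpa [h3] using h2.symm
  simp [hall] at h1

theorem legal_of_isTwoColoring {H : KGraph k (Fin n)} {c : Fin n → Bool} (hc : H.IsTwoColoring c)
    (hn : 0 < n) {f : ℕ → ℕ} (hf : ∀ v : Fin n, f v = (c v).toNat) : Program.Legal H.ask n f := by
  intro j _ hq
  set v : Fin k → Fin n := fun i => ⟨j / n ^ (i : ℕ) % n, Nat.mod_lt _ hn⟩ with hv
  have he : Finset.univ.image v ∈ H.edges := (ask_iff H v).1 hq
  have hsum : ∑ i ∈ Finset.range k, f (j / n ^ i % n) = ∑ i : Fin k, (c (v i)).toNat := by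
    rw [Finset.sum_range]
    exact Finset.sum_congr rfl fun i _ => hf (v i)
  rw [hsum]
  obtain ⟨i, i', h1, h2⟩ : ∃ i i', c (v i) = true ∧ c (v i') = false := by
    obtain ⟨x, hx, y, hy, hxy⟩ := hc _ he
    obtain ⟨i, -, rfl⟩ := Finset.mem_image.1 hx
    obtain ⟨i', -, rfl⟩ := Finset.mem_image.1 hy
    cases h1 : c (v i) <;> cases h2 : c (v i') <;> simp_all
    · exact ⟨⟨i', h2⟩, i, h1⟩
    · exact ⟨⟨i, h1⟩, i', h2⟩
  constructor
  · refine Finset.sum_pos' (fun _ _ => Nat.zero_le _) ⟨i, Finset.mem_univ _, ?_⟩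
    simp [h1]
  · calc _ < ∑ _i : Fin k, 1 :=
          Finset.sum_lt_sum (fun i _ => Bool.toNat_le _) ⟨i', Finset.mem_univ _, by simp [h2]⟩
      _ = k := by simp

theorem card_filter_image_eq {V : Type*} [Fintype V] [DecidableEq V] {W : Finset V}
    (hW : W.card = m) :
    (Finset.univ.filter fun w : Fin m → V => Finset.univ.image w = W).card = m.factorial := by
  have h : Fintype.card (Fin m ↪ W) = m.factorial := by
    rw [Fintype.card_embedding_eq, Fintype.card_coe, hW, Fintype.card_fin, Nat.descFactorial_self]
  rw [← h, ← Finset.card_univ]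
  symm
  refine Finset.card_bij (fun φ _ i => ((φ i : W) : V)) ?_ ?_ ?_
  · intro φ _
    rw [Finset.mem_filter]
    refine ⟨Finset.mem_univ _, Finset.eq_of_subset_of_card_le ?_ ?_⟩
    · intro x hx
      obtain ⟨i, -, rfl⟩ := Finset.mem_image.1 hx
      exact (φ i).2
    · rw [Finset.card_image_of_injective _ fun i j h' => φ.injective (Subtype.ext h')]
      simp [hW]
  · intro φ _ ψ _ h'
    ext i
    exact congrFun h' i
  · intro w hw
    have hw' := (Finset.mem_filter.1 hw).2
    have hinj : Function.Injective w := by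
      rw [← Set.injOn_univ, ← Finset.coe_univ, ← Finset.card_image_iff, hw', hW]
      simp
    exact ⟨⟨fun i => ⟨w i, hw' ▸ Finset.mem_image_of_mem w (Finset.mem_univ i)⟩,
      fun i i' h' => hinj (congrArg Subtype.val h')⟩, Finset.mem_univ _, rfl⟩

/-- An edge has `m + 1` elements, which forces `w` to be injective and to avoid `o` and `u`. Each
`m`-set then arises from its `m.factorial` orderings. -/
theorem card_filter_insert_image (H : KGraph (m + 1) (Fin n)) (o u : Fin n) :
    (Finset.univ.filter fun w : Fin m → Fin n =>
      insert o (Finset.univ.image w) ∈ H.edges ∧ insert u (Finset.univ.image w) ∈ H.edges).card =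
      codegree m H.edges o u * m.factorial := by
  rw [codegree]
  have hmaps : ∀ w ∈ (Finset.univ.filter fun w : Fin m → Fin n =>
      insert o (Finset.univ.image w) ∈ H.edges ∧ insert u (Finset.univ.image w) ∈ H.edges),
      Finset.univ.image w ∈ (({o, u}ᶜ : Finset (Fin n)).powersetCard m |>.filter fun W =>
        insert o W ∈ H.edges ∧ insert u W ∈ H.edges) := by
    intro w hw
    have hw' := (Finset.mem_filter.1 hw).2
    have hle : (Finset.univ.image w).card ≤ m := Finset.card_image_le.trans (by simp)
    have key : ∀ x, insert x (Finset.univ.image w) ∈ H.edges →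
        x ∉ Finset.univ.image w ∧ (Finset.univ.image w).card = m := by
      intro x hx
      have hc : (insert x (Finset.univ.image w)).card = m + 1 := H.sized hx
      have hnot : x ∉ Finset.univ.image w := by
        intro h
        rw [Finset.insert_eq_of_mem h] at hc
        omega
      rw [Finset.card_insert_of_notMem hnot] at hc
      exact ⟨hnot, by omega⟩
    exact Finset.mem_filter.2 ⟨mem_powersetCard_compl_pair.2
      ⟨(key o hw'.1).1, (key u hw'.2).1, (key o hw'.1).2⟩, hw'⟩
  rw [Finset.card_eq_sum_card_fiberwise hmaps, ← smul_eq_mul, ← Finset.sum_const]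
  refine Finset.sum_congr rfl fun W hW => ?_
  rw [Finset.mem_filter, mem_powersetCard_compl_pair] at hW
  rw [← card_filter_image_eq hW.1.2.2, Finset.filter_filter]
  congr 1
  refine Finset.filter_congr fun w _ => ?_
  constructor
  · exact fun h => h.2
  · rintro rfl
    exact ⟨hW.2, rfl⟩

/-- The factor `n` comes from the last digit, which is overwritten and hence free. It does not
depend on `u`, so comparing pair counts is comparing codegrees. -/
theorem pairCount_eq (H : KGraph (m + 1) (Fin n)) {o : Fin n} (ho : (o : ℕ) = 0) (u : Fin n) :
    Program.pairCount H.ask n u = n * (codegree m H.edges o u * m.factorial) := by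
  have hask : ∀ (x z : Fin n) (w : Fin m → Fin n),
      H.ask (Program.tupleLast (m + 1) n
        (finFunctionFinEquiv (Fin.snoc w x : Fin (m + 1) → Fin n)) z) = true ↔
      insert z (Finset.univ.image w) ∈ H.edges := by
    intro x z w
    have h : Program.tupleLast (m + 1) n
        (finFunctionFinEquiv (Fin.snoc w x : Fin (m + 1) → Fin n)) z =
        fun i => ((Fin.snoc w z : Fin (m + 1) → Fin n) i : ℕ) := by
      funext i
      have hd : ((finFunctionFinEquiv (Fin.snoc w x : Fin (m + 1) → Fin n) : ℕ) /
          n ^ (i : ℕ) % n) = (Fin.snoc w x : Fin (m + 1) → Fin n) i := by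
        conv_rhs => rw [← finFunctionFinEquiv.symm_apply_apply (Fin.snoc w x : Fin (m + 1) → Fin n)]
        rfl
      rw [Program.tupleLast, hd]
      refine Fin.lastCases ?_ (fun i => ?_) i
      · simp
      · simp [i.2.ne]
    rw [h, ask_iff]
    have : Finset.univ.image (Fin.snoc w z : Fin (m + 1) → Fin n) =
        insert z (Finset.univ.image w) := by
      ext y
      simp only [Finset.mem_image, Finset.mem_insert, Finset.mem_univ, true_and]
      constructor
      · rintro ⟨i, rfl⟩
        refine Fin.lastCases ?_ (fun i => ?_) i
        · simp
        · simp
      · rintro (rfl | ⟨i, rfl⟩)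
        · exact ⟨Fin.last m, by simp⟩
        · exact ⟨i.castSucc, by simp⟩
    rw [this]
  rw [Program.pairCount, Finset.sum_range, ← finFunctionFinEquiv.sum_comp,
    ← (Fin.snocEquiv fun _ => Fin n).sum_comp, Fintype.sum_prod_type]
  have hx : ∀ x : Fin n, ∑ w : Fin m → Fin n,
      (if insert o (Finset.univ.image w) ∈ H.edges ∧ insert u (Finset.univ.image w) ∈ H.edges
        then 1 else 0) = codegree m H.edges o u * m.factorial := by
    intro x
    rw [← card_filter_insert_image, Finset.card_filter]
  calc _ = ∑ x : Fin n, ∑ w : Fin m → Fin n,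
      (if insert o (Finset.univ.image w) ∈ H.edges ∧ insert u (Finset.univ.image w) ∈ H.edges
        then 1 else 0) := by
        refine Finset.sum_congr rfl fun x _ => Finset.sum_congr rfl fun w _ => ?_
        refine if_congr ?_ rfl rfl
        rw [← hask x o w, ← hask x u w, ho]
        rfl
    _ = _ := by
        rw [Finset.sum_congr rfl fun x _ => hx x]
        simp

/-- Vertex 0 is not covered by `Separates`; its own count is maximal, so it always gets colour 1. -/
theorem pairCount_le_pairCount_zero (q : (Fin k → ℕ) → Bool) (n u : ℕ) :
    Program.pairCount q n u ≤ Program.pairCount q n 0 := by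
  refine Finset.sum_le_sum fun j _ => ?_
  split_ifs with h1 h2
  · exact le_rfl
  · exact absurd ⟨h1.1, h1.1⟩ h2
  · exact Nat.zero_le _
  · exact le_rfl

theorem exists_legal_countColor {H : KGraph (m + 1) (Fin n)} {c : Fin n → Bool}
    (hc : H.IsTwoColoring c) {o : Fin n} (ho : (o : ℕ) = 0) (hn : 4 ≤ n)
    (h : Recognizable m H.edges c o) :
    ∃ w < n, Program.Legal H.ask n (Program.countColor H.ask n w) := by
  obtain ⟨hb, hs⟩ := h
  have hne : ((colorClass c (c o)).erase o).Nonempty := by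
    rw [← Finset.card_pos, Finset.card_erase_of_mem (mem_colorClass.2 rfl)]
    have := hb (c o)
    omega
  -- The right threshold is the least codegree in the class of `o`, with `o` itself left out.
  obtain ⟨w, hw, hmin⟩ := Finset.exists_min_image _ (fun w => codegree m H.edges o w) hne
  rw [Finset.mem_erase, mem_colorClass] at hw
  refine ⟨w, w.2, ?_⟩
  have hc' : H.IsTwoColoring fun v => decide (c v = c o) := by
    intro e he
    obtain ⟨u, hu, v, hv, huv⟩ := hc e he
    refine ⟨u, hu, v, hv, ?_⟩
    cases h1 : c u <;> cases h2 : c v <;> cases h3 : c o <;> simp_all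
  refine legal_of_isTwoColoring hc' (by omega) fun u => ?_
  rw [Program.countColor]
  by_cases hu : c u = c o
  · have hle : Program.pairCount H.ask n w ≤ Program.pairCount H.ask n u := by
      by_cases huo : u = o
      · rw [huo, ho]
        exact pairCount_le_pairCount_zero _ _ _
      · rw [pairCount_eq H ho, pairCount_eq H ho]
        gcongr
        exact hmin u (Finset.mem_erase.2 ⟨huo, mem_colorClass.2 hu⟩)
    simp [hu, hle]
  · have hlt : Program.pairCount H.ask n u < Program.pairCount H.ask n w := by
      rw [pairCount_eq H ho, pairCount_eq H ho]
      have := hs w u hw.1 hw.2 hu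
      have := m.factorial_pos
      gcongr
    simp [hu, hlt]

end Queries

end KGraph

namespace Program

/-! ### Running times -/

open Classical in
theorem exists_exec_colorer {k n : ℕ} (hn : 0 < n) (hk : 0 < k) {H : KGraph k (Fin n)}
    (hH : H.TwoColorable) :
    ∃ t s, t ≤ tryCountsTime n k + 7 +
        (if ∃ w < n, Legal H.ask n (countColor H.ask n w) then 0 else tryAllTime n k) ∧
      Exec H.ask colorer (init k n) t s ∧ (∀ m < n, s.mem m ≤ 1) ∧ Legal H.ask n s.mem := by
  refine colorer_within hn hk ?_
  obtain ⟨c, hc⟩ := hH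
  refine ⟨fun m => if h : m < n then (c ⟨m, h⟩).toNat else 0, fun m hm => ?_,
    KGraph.legal_of_isTwoColoring hc hn fun v => by simp⟩
  simp only [hm, dif_pos]
  exact Bool.toNat_le _

theorem isTwoColoringAlgorithm_colorer {k : ℕ} (hk : 0 < k) :
    IsTwoColoringAlgorithm colorer k := by
  intro n H hH
  rcases Nat.eq_zero_or_pos n with rfl | hn
  · obtain ⟨c, hc⟩ := hH
    exact ⟨2, _, c, .branch_false (by simp [init]) (.instr _ _), hc, fun v => v.elim0⟩
  · obtain ⟨t, s, -, he, h1, hL⟩ := exists_exec_colorer hn hk hH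
    refine ⟨t, s, _, he, KGraph.isTwoColoring_of_legal h1 hL, fun v => ?_⟩
    have := h1 v v.2
    interval_cases s.mem v <;> simp

/-! ### Polynomial bounds in `X = n ^ k` -/

section Bounds

variable {n k X : ℕ}

theorem decodeTime_le (hkX : k ≤ X) (hX : 16 ≤ X) : decodeTime X k ≤ X ^ 3 := by
  unfold decodeTime
  calc k * (3 * X + 7) + 3 ≤ X * (3 * X + 7) + 3 := by gcongr
    _ ≤ X * X * 16 := by nlinarith
    _ ≤ X * X * X := by gcongr
    _ = X ^ 3 := by ring

theorem tuplesTime_le {T : ℕ} (hT : T ≤ X ^ 2) (hkX : k ≤ X) (hX : 16 ≤ X) (h : X = n ^ k) :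
    tuplesTime n k T ≤ X ^ 5 := by
  have := decodeTime_le hkX hX
  unfold tuplesTime
  rw [← h]
  have h2 : X ^ 2 * 16 ≤ X ^ 3 := by rw [pow_succ X 2]; gcongr
  have h3 : X ^ 3 * 16 ≤ X ^ 4 := by rw [pow_succ X 3]; gcongr
  have h4 : X ^ 4 * 16 ≤ X ^ 5 := by rw [pow_succ X 4]; gcongr
  calc (X + 1) * (T + decodeTime X k + 3) + 3 ≤ (2 * X) * (3 * X ^ 3) + 3 := by
        gcongr <;> nlinarith
    _ = 6 * X ^ 4 + 3 := by ring
    _ ≤ X ^ 5 := by nlinarith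

theorem countTime_le (hkX : k ≤ X) (hX : 16 ≤ X) (h : X = n ^ k) : countTime n k ≤ X ^ 6 := by
  have h1 := tuplesTime_le (T := 7) (by nlinarith) hkX hX h
  have h2 : X ^ 5 * 16 ≤ X ^ 6 := by rw [pow_succ X 5]; gcongr
  have h3 : 1 ≤ X ^ 5 := Nat.one_le_pow _ _ (by omega)
  unfold countTime
  omega

theorem checkTime_le (hkX : k ≤ X) (hX : 16 ≤ X) (h : X = n ^ k) : checkTime n k ≤ X ^ 6 := by
  have h1 := tuplesTime_le (T := k * 6 + 8) (by nlinarith) hkX hX h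
  have h2 : X ^ 5 * 16 ≤ X ^ 6 := by rw [pow_succ X 5]; gcongr
  have h3 : 1 ≤ X ^ 5 := Nat.one_le_pow _ _ (by omega)
  unfold checkTime
  omega

theorem tryCountsTime_le (hnX : n ≤ X) (hkX : k ≤ X) (hX : 16 ≤ X) (h : X = n ^ k) :
    tryCountsTime n k + 7 ≤ X ^ 10 := by
  have h1 := countTime_le hkX hX h
  have h2 := checkTime_le hkX hX h
  have e6 : 1 ≤ X ^ 6 := Nat.one_le_pow _ _ (by omega)
  have e7 : X ^ 6 * 16 ≤ X ^ 7 := by rw [pow_succ X 6]; gcongr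
  have e8 : X ^ 7 * 16 ≤ X ^ 8 := by rw [pow_succ X 7]; gcongr
  have e9 : X ^ 8 * 16 ≤ X ^ 9 := by rw [pow_succ X 8]; gcongr
  have e10 : X ^ 9 * 16 ≤ X ^ 10 := by rw [pow_succ X 9]; gcongr
  have h3 : colorTime n k ≤ X ^ 8 := by
    unfold colorTime
    calc (n + 1) * (countTime n k + 4) + 3 ≤ (2 * X) * (5 * X ^ 6) + 3 := by
          gcongr <;> omega
      _ = 10 * X ^ 7 + 3 := by ring
      _ ≤ X ^ 8 := by omega
  unfold tryCountsTime
  calc n * (colorTime n k + checkTime n k + 4) + 1 + 7 ≤ X * (6 * X ^ 8) + 8 := by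
        have : colorTime n k + checkTime n k + 4 ≤ 6 * X ^ 8 := by omega
        have := Nat.mul_le_mul hnX this
        omega
    _ = 6 * X ^ 9 + 8 := by ring
    _ ≤ X ^ 10 := by omega

/-- One factor `2 ^ n` counts the candidates. The other one pays for decoding a counter of that
size, because division is done by repeated subtraction. -/
theorem tryAllTime_le (hnX : n ≤ X) (hkX : k ≤ X) (hX : 16 ≤ X) (h : X = n ^ k) :
    tryAllTime n k ≤ 4 ^ n * X ^ 7 := by
  have h2 := checkTime_le hkX hX h
  have e5 : X * 16 ≤ X ^ 2 := by rw [pow_succ X 1, pow_one]; gcongr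
  have e6 : X ^ 2 ≤ X ^ 6 := Nat.pow_le_pow_right (by omega) (by omega)
  have e7 : X ^ 6 * 16 ≤ X ^ 7 := by rw [pow_succ X 6]; gcongr
  have h1 : 1 ≤ 2 ^ n := Nat.one_le_two_pow
  have h3 : decodeTime (2 ^ n) n ≤ 2 ^ n * (X ^ 6) := by
    unfold decodeTime
    calc n * (3 * 2 ^ n + 7) + 3 ≤ X * (10 * 2 ^ n) + 3 * 2 ^ n := by
          have : 3 * 2 ^ n + 7 ≤ 10 * 2 ^ n := by omega
          have := Nat.mul_le_mul hnX this
          omega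
      _ = 2 ^ n * (10 * X + 3) := by ring
      _ ≤ _ := by
          gcongr
          omega
  have h4 : checkTime n k + 3 ≤ 2 ^ n * (4 * X ^ 6) := by nlinarith
  unfold tryAllTime
  calc 2 ^ n * (decodeTime (2 ^ n) n + checkTime n k + 3) + 1
      ≤ 2 ^ n * (2 ^ n * (5 * X ^ 6)) + 2 ^ n * 2 ^ n := by
        have h5 : decodeTime (2 ^ n) n + checkTime n k + 3 ≤ 2 ^ n * (5 * X ^ 6) := by linarith
        have := Nat.mul_le_mul_left (2 ^ n) h5
        nlinarith
    _ = 4 ^ n * (5 * X ^ 6 + 1) := by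
        rw [show 4 = 2 * 2 from rfl, mul_pow]; ring
    _ ≤ _ := by
        gcongr
        omega

end Bounds

theorem eventually_averageTime_colorer_le {k : ℕ} (hk : 3 ≤ k) :
    ∀ᶠ n : ℕ in atTop, averageTime colorer k n ≤ (n : ℝ) ^ (11 * k) := by
  classical
  obtain ⟨m, rfl⟩ : ∃ m, k = m + 1 := ⟨k - 1, by omega⟩
  filter_upwards [KGraph.eventually_card_not_recognizable_le m (by omega),
    eventually_ge_atTop (16 + m)] with n hbad hn
  set o : Fin n := ⟨0, by omega⟩
  specialize hbad o
  obtain ⟨X, hX⟩ : ∃ X, X = n ^ (m + 1) := ⟨_, rfl⟩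
  have hnX : n ≤ X := hX ▸ Nat.le_self_pow (by omega) n
  have hA := tryCountsTime_le hnX (by omega) (by omega) hX
  have hB := tryAllTime_le hnX (by omega) (by omega) hX
  set F := KGraph.twoColorable (m + 1) n with hF
  set B := F.filter fun H => ¬ ∃ c, H.IsTwoColoring c ∧ KGraph.Recognizable m H.edges c o with hBdef
  have hFpos : 0 < F.card :=
    lt_of_lt_of_le (by positivity) (KGraph.two_pow_card_crossing_le fun _ : Fin n => true)
  have htime : ∀ H ∈ F, (time colorer H : ℝ) ≤ (X : ℝ) ^ 10 +
      if ¬ ∃ c, H.IsTwoColoring c ∧ KGraph.Recognizable m H.edges c o then 4 ^ n * (X : ℝ) ^ 7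
        else 0 := by
    intro H hH
    obtain ⟨t, s, ht, he, -⟩ := exists_exec_colorer (by omega) (by omega)
      (Finset.mem_filter.1 hH).2
    rw [time_eq he]
    have : t ≤ X ^ 10 + if ¬ ∃ c, H.IsTwoColoring c ∧ KGraph.Recognizable m H.edges c o then
        4 ^ n * X ^ 7 else 0 := by
      refine ht.trans (add_le_add hA ?_)
      by_cases hR : ∃ c, H.IsTwoColoring c ∧ KGraph.Recognizable m H.edges c o
      · obtain ⟨c, hc, hc'⟩ := hR
        rw [if_pos (KGraph.exists_legal_countColor hc rfl (by omega) hc')]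
        exact Nat.zero_le _
      · rw [if_pos hR]
        split_ifs
        · exact Nat.zero_le _
        · exact hB
    exact_mod_cast this
  have hsum : ∑ H ∈ F, (time colorer H : ℝ) ≤ F.card * (X : ℝ) ^ 10 +
      B.card * (4 ^ n * (X : ℝ) ^ 7) := by
    refine (Finset.sum_le_sum htime).trans (le_of_eq ?_)
    rw [Finset.sum_add_distrib, Finset.sum_const, nsmul_eq_mul, ← Finset.sum_filter,
      Finset.sum_const, nsmul_eq_mul]
  -- The available saving is `8 ^ n`; the exhaustive search needs only `4 ^ n` of it.
  have hB4 : (B.card : ℝ) * 4 ^ n ≤ n * F.card := by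
    refine le_trans ?_ hbad
    gcongr
    norm_num
  have hX16 : (16 : ℝ) ≤ X := by exact_mod_cast (by omega : 16 ≤ X)
  have hnX' : (n : ℝ) ≤ X := by exact_mod_cast hnX
  rw [averageTime, div_le_iff₀ (by exact_mod_cast hFpos)]
  calc _ ≤ F.card * (X : ℝ) ^ 10 + B.card * (4 ^ n * (X : ℝ) ^ 7) := hsum
    _ = F.card * (X : ℝ) ^ 10 + (B.card * 4 ^ n) * (X : ℝ) ^ 7 := by ring
    _ ≤ F.card * (X : ℝ) ^ 10 + (n * F.card) * (X : ℝ) ^ 7 := by gcongr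
    _ ≤ F.card * (X : ℝ) ^ 10 + (X * F.card) * (X : ℝ) ^ 7 := by gcongr
    _ = F.card * ((X : ℝ) ^ 10 + (X : ℝ) ^ 8) := by ring
    _ ≤ F.card * ((X : ℝ) ^ 10 * 2) := by
        gcongr
        rw [mul_two]
        gcongr
        · linarith
        · norm_num
    _ ≤ F.card * ((X : ℝ) ^ 10 * X) := by gcongr; linarith
    _ = (n : ℝ) ^ (11 * (m + 1)) * F.card := by
        rw [hX]
        push_cast
        ring

end Program

theorem mainTheorem3 :
    ∃ (P : Program) (C : ℕ), ∀ k : ℕ, 3 ≤ k →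
      P.IsTwoColoringAlgorithm k ∧
      ∀ᶠ n : ℕ in atTop, P.averageTime k n ≤ (n : ℝ) ^ (C * k) :=
  ⟨Program.colorer, 11, fun _ hk => ⟨Program.isTwoColoringAlgorithm_colorer (by omega),
    Program.eventually_averageTime_colorer_le hk⟩⟩
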